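/- Let $n\ge 4$ and $3\le k\le n$ be integers, let $1<p<n$, put $p_1^*:=\frac{p(n-1)}{n-p}$, and write $x=(y,z)\in\mathbb{R}^k\times\mathbb{R}^{n-k}$ for the points of $\mathbb{R}^n$. For a fixed $a>0$ let $$v(x):=a\bigl[(1+|y|)^2+|z|^2\bigr]^{-\frac{n-p}{2(p-1)}}.$$ For every $\varphi\in C_c^\infty(\mathbb{R}^n)$ the norms $$\|\varphi\|_{D}:=\Bigl(\int_{\mathbb{R}^n}|Dv|^{p-2}|D\varphi|^2\,dx\Bigr)^{1/2}\quad\text{and}\quad \|\varphi\|_{L}:=\Bigl(\int_{\mathbb{R}^n}|y|^{-1}v^{p_1^*-2}\varphi^2\,dx\Bigr)^{1/2}$$ are finite. Let $D^{1,2}(\mathbb{R}^n;|Dv|^{p-2})$ be the closure (that is, the completion) of $C_c^\infty(\mathbb{R}^n)$ with respect to $\|\cdot\|_D$, and let $L^2(\mathbb{R}^n;|y|^{-1}v^{p_1^*-2})$ be the weighted $L^2$ space with norm $\|\cdot\|_L$. Then $D^{1,2}(\mathbb{R}^n;|Dv|^{p-2})$ embeds compactly into $L^2(\mathbb{R}^n;|y|^{-1}v^{p_1^*-2})$: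 the inclusion $\varphi\mapsto\varphi$ of $C_c^\infty(\mathbb{R}^n)$ extends to a bounded linear map $$J:D^{1,2}(\mathbb{R}^n;|Dv|^{p-2})\to L^2(\mathbb{R}^n;|y|^{-1}v^{p_1^*-2})$$ which is injective and compact. -/

import Mathlib

open MeasureTheory

noncomputable section

namespace HardySobolevMazya

/-- `ℝⁿ` with its Euclidean norm and Lebesgue measure. -/
abbrev E (n : ℕ) : Type := EuclideanSpace ℝ (Fin n)

/-- `|y|` for `x = (y, z) ∈ ℝᵏ × ℝⁿ⁻ᵏ`, where `y` consists of the first `k` coordinates of `x`. -/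
def normY (n k : ℕ) (x : E n) : ℝ :=
  Real.sqrt (∑ i ∈ Finset.univ.filter (fun i : Fin n => i.val < k), x i ^ 2)

/-- `|z|` for `x = (y, z) ∈ ℝᵏ × ℝⁿ⁻ᵏ`, where `z` consists of the last `n - k` coordinates. -/
def normZ (n k : ℕ) (x : E n) : ℝ :=
  Real.sqrt (∑ i ∈ Finset.univ.filter (fun i : Fin n => k ≤ i.val), x i ^ 2)

/-- The critical exponent `p₁* = p (n - 1) / (n - p)`. -/
def critExp (n : ℕ) (p : ℝ) : ℝ := p * ((n : ℝ) - 1) / ((n : ℝ) - p)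

/-- The extremal function `v(x) = a [(1 + |y|)² + |z|²] ^ (-(n - p) / (2 (p - 1)))`. -/
def extremal (n k : ℕ) (p a : ℝ) (x : E n) : ℝ :=
  a * ((1 + normY n k x) ^ 2 + normZ n k x ^ 2) ^ (-((n : ℝ) - p) / (2 * (p - 1)))

/-- The measure `w dx` on `ℝⁿ` for a nonnegative weight `w`. -/
def weighted {n : ℕ} (w : E n → ℝ) : Measure (E n) :=
  volume.withDensity fun x => ENNReal.ofReal (w x)

/-- The weight `|Dv| ^ (p - 2)`. (`v` is differentiable off the Lebesgue null set `{y = 0}`.) -/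
def gradWeight (n k : ℕ) (p a : ℝ) (x : E n) : ℝ :=
  ‖gradient (extremal n k p a) x‖ ^ (p - 2)

/-- The weight `|y|⁻¹ v ^ (p₁* - 2)`. -/
def massWeight (n k : ℕ) (p a : ℝ) (x : E n) : ℝ :=
  (normY n k x)⁻¹ * extremal n k p a x ^ (critExp n p - 2)

/-- `φ ∈ C_c^∞(ℝⁿ)`. -/
def IsTest {n : ℕ} (φ : E n → ℝ) : Prop :=
  ContDiff ℝ (⊤ : ℕ∞) φ ∧ HasCompactSupport φ

theorem IsTest.differentiable {n : ℕ} {φ : E n → ℝ} (h : IsTest φ) : Differentiable ℝ φ :=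
  h.1.differentiable (by simp)

theorem IsTest.gradient_add {n : ℕ} {φ ψ : E n → ℝ} (hφ : IsTest φ) (hψ : IsTest ψ) :
    gradient (φ + ψ) = gradient φ + gradient ψ := by
  funext x
  simp only [gradient, Pi.add_apply]
  rw [fderiv_add (hφ.differentiable x) (hψ.differentiable x), map_add]

theorem IsTest.gradient_smul {n : ℕ} {φ : E n → ℝ} (c : ℝ) (hφ : IsTest φ) :
    gradient (c • φ) = c • gradient φ := by
  funext x
  simp only [gradient, Pi.smul_apply]
  rw [fderiv_const_smul (hφ.differentiable x), map_smulₛₗ]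
  simp

/-- The linear space of all `φ ∈ C_c^∞(ℝⁿ)` with `∫ |Dφ|² dμ < ∞`. If `μ` is locally finite, these
are all `φ ∈ C_c^∞(ℝⁿ)`. -/
def testSubmodule {n : ℕ} (μ : Measure (E n)) : Submodule ℝ (E n → ℝ) where
  carrier := {φ | IsTest φ ∧ MemLp (gradient φ) 2 μ}
  add_mem' := by
    rintro φ ψ ⟨h1, h2⟩ ⟨h3, h4⟩
    refine ⟨⟨h1.1.add h3.1, h1.2.add h3.2⟩, ?_⟩
    rw [h1.gradient_add h3]
    exact h2.add h4
  zero_mem' := by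
    have h0 : gradient (0 : E n → ℝ) = 0 := by
      funext x
      simp [gradient]
    refine ⟨⟨contDiff_const, HasCompactSupport.zero⟩, ?_⟩
    rw [h0]
    exact MemLp.zero
  smul_mem' := by
    rintro c φ ⟨h1, h2⟩
    refine ⟨⟨contDiff_const.smul h1.1, h1.2.mono (Function.support_const_smul_subset c φ)⟩, ?_⟩
    rw [h1.gradient_smul c]
    exact h2.const_smul c

/-- The same space, as a type that is to carry the norm `(∫ |Dφ|² dμ) ^ (1/2)`. -/
def TestSpace {n : ℕ} (μ : Measure (E n)) : Type := testSubmodule μ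

instance {n : ℕ} (μ : Measure (E n)) : AddCommGroup (TestSpace μ) :=
  inferInstanceAs (AddCommGroup (testSubmodule μ))

instance {n : ℕ} (μ : Measure (E n)) : Module ℝ (TestSpace μ) :=
  inferInstanceAs (Module ℝ (testSubmodule μ))

/-- The function underlying an element of `TestSpace μ`. -/
def TestSpace.toFun {n : ℕ} {μ : Measure (E n)} (φ : TestSpace μ) : E n → ℝ :=
  (show testSubmodule μ from φ).1

theorem TestSpace.isTest {n : ℕ} {μ : Measure (E n)} (φ : TestSpace μ) : IsTest φ.toFun :=
  (show testSubmodule μ from φ).2.1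

theorem TestSpace.memLp {n : ℕ} {μ : Measure (E n)} (φ : TestSpace μ) :
    MemLp (gradient φ.toFun) 2 μ :=
  (show testSubmodule μ from φ).2.2

/-- The gradient `φ ↦ Dφ` as a linear map into `L²(μ; ℝⁿ)`. -/
def gradMap {n : ℕ} (μ : Measure (E n)) : TestSpace μ →ₗ[ℝ] Lp (E n) 2 μ where
  toFun φ := φ.memLp.toLp _
  map_add' φ ψ := by
    rw [← MemLp.toLp_add]
    exact MemLp.toLp_congr _ _
      (Filter.EventuallyEq.of_eq (φ.isTest.gradient_add ψ.isTest))
  map_smul' c φ := by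
    rw [RingHom.id_apply, ← MemLp.toLp_const_smul]
    exact MemLp.toLp_congr _ _
      (Filter.EventuallyEq.of_eq (φ.isTest.gradient_smul c))

/-- The (semi)norm `‖φ‖ = (∫ |Dφ|² dμ) ^ (1/2)`. -/
instance {n : ℕ} (μ : Measure (E n)) : SeminormedAddCommGroup (TestSpace μ) :=
  SeminormedAddCommGroup.induced (TestSpace μ) (Lp (E n) 2 μ) (gradMap μ)

instance {n : ℕ} (μ : Measure (E n)) : NormedSpace ℝ (TestSpace μ) :=
  NormedSpace.induced ℝ (TestSpace μ) (Lp (E n) 2 μ) (gradMap μ)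

/-- `D^{1,2}(ℝⁿ; w)`, where `μ = w dx`: the closure (completion) of `C_c^∞(ℝⁿ)` with respect to
the norm `(∫ w |Dφ|² dx) ^ (1/2)`. -/
abbrev D12 {n : ℕ} (μ : Measure (E n)) : Type := UniformSpace.Completion (TestSpace μ)

end HardySobolevMazya

end

/-!
Write `⟨x⟩² = 1 + |x|²` and `A = (1 + |y|)² + |z|²`, so that `⟨x⟩² ≤ A ≤ 2⟨x⟩²` and `v` is a
multiple of a power of `A`. Off the null set `{y = 0}` one has `|DA|² = 4A`, so `|Dv|^(p-2)` is a
multiple of `A^β` with `2β = -(n-1)(p-2)/(p-1)`, and the mass weight is a multiple of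
`|y|⁻¹ A^(β-1)`. Both weights are comparable to what one gets with the smooth `⟨x⟩²` in place of
`A`, and `n + 2β - 2 = (n-p)/(p-1)` is positive.

Two vector fields give all the inequalities. The divergence of `⟨x⟩^(2β-2) x` is at least a positive
multiple of `⟨x⟩^(2β-2)`, which yields the Hardy inequality `exists_hardy`,
`∫ ⟨x⟩^(2β-2) φ² ≤ C ∫ ⟨x⟩^(2β) |Dφ|²`. The divergence of `⟨x⟩^(2β-2) y/|y|` (regularized at
`y = 0`) is at least `(k-1) |y|⁻¹ ⟨x⟩^(2β-2)` up to a multiple of `⟨x⟩^(2β-3)`. Since this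
last weight is small compared with `⟨x⟩^(2β-2)` far out, the two together bound the mass by `ε ∫ ⟨x⟩^(2β) |Dφ|²`
plus a multiple of the unweighted mass in a large ball (`exists_lintegral_mass_le`). No mass is lost
at infinity or at `y = 0`.

The mass in a ball is treated by cutting the ball into finitely many small convex cells. The
Poincaré inequality on each cell (`IsTest.setIntegral_sq_le`) bounds it by `ε ∫ |Dφ|²` and finitely many
averages of `φ`. So the inclusion is, up to an arbitrarily small multiple of the Dirichlet norm,
controlled by a bounded map of finite rank, and is therefore compact
(`isCompactOperator_of_norm_le_add_finiteRank`).

The extension to the completion is injective because the gradient of a member of the completion is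
the distributional gradient of its image: both weights are locally bounded below, so integration by
parts against a test function passes to the limit. If the image vanishes, so does the gradient, and
the norm on the completion is the norm of the gradient.
-/

noncomputable section

namespace HardySobolevMazya

/-! ### Smooth weights and gradients of test functions -/

/-- The squared Japanese bracket `⟨x⟩² = 1 + |x|²`. -/
def japSq {n : ℕ} (x : E n) : ℝ := 1 + ‖x‖ ^ 2

/-- The partial sum of squares `∑ i ∈ S, xᵢ²`; it is `|y|²` if `S` consists of the first `k`
coordinates, and `|x|²` if `S` is everything. -/
def sqOn {n : ℕ} (S : Finset (Fin n)) (x : E n) : ℝ := ∑ i ∈ S, x i ^ 2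

section Basics

variable {n : ℕ}

theorem one_le_japSq (x : E n) : 1 ≤ japSq x := by
  unfold japSq; nlinarith [sq_nonneg ‖x‖]

theorem japSq_pos (x : E n) : 0 < japSq x := lt_of_lt_of_le one_pos (one_le_japSq x)

theorem contDiff_japSq {m : WithTop ℕ∞} : ContDiff ℝ m (japSq : E n → ℝ) :=
  contDiff_const.add (contDiff_norm_sq ℝ)

theorem contDiff_japSq_rpow {m : WithTop ℕ∞} (b : ℝ) :
    ContDiff ℝ m (fun x : E n => japSq x ^ b) :=
  contDiff_japSq.rpow_const_of_ne fun x => (japSq_pos x).ne'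

theorem continuous_japSq_rpow (b : ℝ) : Continuous fun x : E n => japSq x ^ b :=
  (contDiff_japSq_rpow (m := 0) b).continuous

theorem sqOn_nonneg (S : Finset (Fin n)) (x : E n) : 0 ≤ sqOn S x :=
  Finset.sum_nonneg fun i _ => sq_nonneg (x i)

theorem sqOn_univ (x : E n) : sqOn Finset.univ x = ‖x‖ ^ 2 := by
  rw [EuclideanSpace.norm_sq_eq]; simp [sqOn]

theorem sqOn_le_norm_sq (S : Finset (Fin n)) (x : E n) : sqOn S x ≤ ‖x‖ ^ 2 := by
  rw [← sqOn_univ]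
  exact Finset.sum_le_sum_of_subset_of_nonneg (Finset.subset_univ S) fun i _ _ => sq_nonneg _

theorem contDiff_coord {m : WithTop ℕ∞} (i : Fin n) : ContDiff ℝ m (fun x : E n => x i) :=
  (EuclideanSpace.proj (𝕜 := ℝ) i).contDiff

theorem contDiff_sqOn {m : WithTop ℕ∞} (S : Finset (Fin n)) :
    ContDiff ℝ m (sqOn S : E n → ℝ) :=
  ContDiff.sum fun i _ => (contDiff_coord i).pow 2

theorem IsTest.hasCompactSupport_gradient {φ : E n → ℝ} (h : IsTest φ) :
    HasCompactSupport (gradient φ) :=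
  (h.2.fderiv (𝕜 := ℝ)).comp_left (map_zero _)

theorem IsTest.hasCompactSupport_sq {φ : E n → ℝ} (hφ : IsTest φ) :
    HasCompactSupport fun x => φ x ^ 2 := hφ.2.comp_left (g := fun t : ℝ => t ^ 2) (by simp)

theorem IsTest.hasCompactSupport_norm_gradient_sq {φ : E n → ℝ} (hφ : IsTest φ) :
    HasCompactSupport fun x => ‖gradient φ x‖ ^ 2 :=
  hφ.hasCompactSupport_gradient.comp_left (g := fun v : E n => ‖v‖ ^ 2) (by simp)

theorem IsTest.continuous_gradient {φ : E n → ℝ} (h : IsTest φ) : Continuous (gradient φ) :=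
  (InnerProductSpace.toDual ℝ (E n)).symm.continuous.comp (h.1.continuous_fderiv (by simp))

theorem fderiv_eq_inner_gradient {φ : E n → ℝ} (x v : E n) :
    fderiv ℝ φ x v = inner ℝ (gradient φ x) v := by
  simp [gradient]

theorem fderiv_single {φ : E n → ℝ} (x : E n) (i : Fin n) :
    fderiv ℝ φ x (EuclideanSpace.single i 1) = gradient φ x i := by
  rw [fderiv_eq_inner_gradient, EuclideanSpace.inner_single_right]; simp

theorem norm_gradient {φ : E n → ℝ} (x : E n) : ‖gradient φ x‖ = ‖fderiv ℝ φ x‖ := by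
  simp [gradient]

end Basics

/-! ### Integration by parts -/

section Divergence

variable {n : ℕ}

/-- Integration by parts of `∂ᵢ(φ² X)` against Lebesgue measure. -/
theorem IsTest.integral_sq_mul_deriv {φ : E n → ℝ} (hφ : IsTest φ) {X : E n → ℝ}
    (hX : ContDiff ℝ 1 X) (i : Fin n) :
    ∫ x, φ x ^ 2 * fderiv ℝ X x (EuclideanSpace.single i 1) =
      - ∫ x, 2 * φ x * gradient φ x i * X x := by
  have hc : ContDiff ℝ 1 φ := hφ.1.of_le (by exact_mod_cast le_top)
  have hd : ContDiff ℝ 1 fun x => φ x ^ 2 := hc.pow 2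
  have hs := hφ.hasCompactSupport_sq
  have hf : ∀ x, fderiv ℝ (fun x => φ x ^ 2) x (EuclideanSpace.single i 1)
      = 2 * φ x * gradient φ x i := by
    intro x
    have := ((hφ.differentiable x).hasFDerivAt.pow 2).fderiv
    rw [this, ← fderiv_single]
    simp
  have hcd : Continuous fun x => fderiv ℝ (fun x => φ x ^ 2) x (EuclideanSpace.single i 1) :=
    (hd.continuous_fderiv one_ne_zero).clm_apply continuous_const
  have hcX : Continuous fun x => fderiv ℝ X x (EuclideanSpace.single i 1) :=
    (hX.continuous_fderiv one_ne_zero).clm_apply continuous_const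
  have := integral_mul_fderiv_eq_neg_fderiv_mul_of_integrable (μ := (volume : Measure (E n)))
    (f := fun x => φ x ^ 2) (g := X) (v := EuclideanSpace.single i 1)
    ((hcd.mul hX.continuous).integrable_of_hasCompactSupport
      ((hs.fderiv_apply (𝕜 := ℝ) _).mul_right))
    ((hd.continuous.mul hcX).integrable_of_hasCompactSupport hs.mul_right)
    ((hd.continuous.mul hX.continuous).integrable_of_hasCompactSupport hs.mul_right)
    (fun x _ => hd.differentiable one_ne_zero x) (fun x _ => hX.differentiable one_ne_zero x)
  rw [this]
  simp only [hf]

theorem hasFDerivAt_japSq (x : E n) : HasFDerivAt japSq (2 • innerSL ℝ x) x :=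
  ((hasStrictFDerivAt_norm_sq x).hasFDerivAt).const_add 1

theorem hasFDerivAt_sqOn (S : Finset (Fin n)) (x : E n) :
    HasFDerivAt (sqOn S)
      (∑ i ∈ S, (2 * x i) • (EuclideanSpace.proj i : E n →L[ℝ] ℝ)) x := by
  have : ∀ i ∈ S, HasFDerivAt (fun x : E n => x i ^ 2)
      ((2 * x i) • (EuclideanSpace.proj i : E n →L[ℝ] ℝ)) x := by
    intro i _
    have := ((EuclideanSpace.proj i : E n →L[ℝ] ℝ).hasFDerivAt (x := x)).pow 2
    simpa using this
  exact HasFDerivAt.fun_sum this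

/-- The divergence identity for the field `⟨x⟩^{2b} (d + |x_S|²)^c x_S`, where `x_S` is the part
of `x` with coordinates in `S`. -/
theorem IsTest.integral_sq_mul_div {φ : E n → ℝ} (hφ : IsTest φ) (S : Finset (Fin n)) (b c : ℝ)
    {d : ℝ} (hd : 0 < d) :
    ∫ x, φ x ^ 2 * (S.card * (japSq x ^ b * (d + sqOn S x) ^ c)
        + 2 * b * (japSq x ^ (b - 1) * (d + sqOn S x) ^ c * sqOn S x)
        + 2 * c * (japSq x ^ b * (d + sqOn S x) ^ (c - 1) * sqOn S x)) =
      - ∫ x, 2 * φ x * (japSq x ^ b * (d + sqOn S x) ^ c) * ∑ i ∈ S, x i * gradient φ x i := by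
  have hpos : ∀ x : E n, 0 < d + sqOn S x := fun x => by linarith [sqOn_nonneg S x]
  have hRC : ∀ e : ℝ, ContDiff ℝ 1 fun x : E n => (d + sqOn S x) ^ e := fun e =>
    (contDiff_const.add (contDiff_sqOn S)).rpow_const_of_ne fun x => (hpos x).ne'
  have hX : ∀ i : Fin n, ContDiff ℝ 1 fun x : E n => japSq x ^ b * (d + sqOn S x) ^ c * x i :=
    fun i => ((contDiff_japSq_rpow b).mul (hRC c)).mul (contDiff_coord i)
  have hder : ∀ i ∈ S, ∀ x : E n, fderiv ℝ (fun x : E n => japSq x ^ b * (d + sqOn S x) ^ c * x i) x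
      (EuclideanSpace.single i 1) = japSq x ^ b * (d + sqOn S x) ^ c
        + 2 * b * (japSq x ^ (b - 1) * (d + sqOn S x) ^ c * x i ^ 2)
        + 2 * c * (japSq x ^ b * (d + sqOn S x) ^ (c - 1) * x i ^ 2) := by
    intro i hi x
    have h1 := (hasFDerivAt_japSq x).rpow_const (p := b) (Or.inl (japSq_pos x).ne')
    have h2 := ((hasFDerivAt_sqOn S x).const_add d).rpow_const (p := c) (Or.inl (hpos x).ne')
    have h3 : HasFDerivAt (fun x : E n => x i) (EuclideanSpace.proj i : E n →L[ℝ] ℝ) x :=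
      (EuclideanSpace.proj i : E n →L[ℝ] ℝ).hasFDerivAt
    have h4 := (h1.fun_mul h2).fun_mul h3
    have h5 : (∑ j ∈ S, (2 * x j) • (EuclideanSpace.proj j : E n →L[ℝ] ℝ))
        (EuclideanSpace.single i 1) = 2 * x i := by
      simp [PiLp.single_apply, hi]
    have h6 : (innerSL ℝ x) (EuclideanSpace.single i 1) = x i := by
      simp [EuclideanSpace.inner_single_right]
    have h7 : (EuclideanSpace.proj i : E n →L[ℝ] ℝ) (EuclideanSpace.single i 1) = 1 := by simp
    rw [h4.fderiv]
    simp only [add_apply, smul_apply, h5, h6, h7, smul_eq_mul]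
    simp
    ring
  have hcs := hφ.hasCompactSupport_sq
  have hcont := hφ.1.continuous
  have hi1 : ∀ i ∈ S, Integrable fun x : E n => φ x ^ 2 *
      fderiv ℝ (fun x : E n => japSq x ^ b * (d + sqOn S x) ^ c * x i) x
      (EuclideanSpace.single i 1) := fun i _ =>
    ((hcont.pow 2).mul (((hX i).continuous_fderiv one_ne_zero).clm_apply
      continuous_const)).integrable_of_hasCompactSupport hcs.mul_right
  have hi2 : ∀ i ∈ S, Integrable fun x : E n => 2 * φ x * gradient φ x i *
      (japSq x ^ b * (d + sqOn S x) ^ c * x i) := by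
    intro i _
    refine (((continuous_const.mul hcont).mul ((contDiff_coord (m := 0) i).continuous.comp
      hφ.continuous_gradient)).mul (hX i).continuous).integrable_of_hasCompactSupport ?_
    exact ((hφ.2.mul_left (f := fun _ => (2:ℝ))).mul_right).mul_right
  have hsum := Finset.sum_congr rfl fun i (_ : i ∈ S) => hφ.integral_sq_mul_deriv (hX i) i
  rw [← integral_finsetSum _ hi1, Finset.sum_neg_distrib, ← integral_finsetSum _ hi2] at hsum
  convert hsum using 1
  · congr 1; ext x
    rw [← Finset.mul_sum, Finset.sum_congr rfl fun i hi => hder i hi x, Finset.sum_add_distrib,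
      Finset.sum_add_distrib, Finset.sum_const, nsmul_eq_mul]
    simp only [← Finset.mul_sum]
    rfl
  · congr 2; ext x
    rw [Finset.mul_sum]
    exact Finset.sum_congr rfl fun i _ => by ring

end Divergence

/-! ### Weighted Hardy inequalities -/

section WeightedHardy

variable {n : ℕ}

theorem IsTest.integrable_sq_mul {φ : E n → ℝ} (hφ : IsTest φ) {u : E n → ℝ} (hu : Continuous u) :
    Integrable fun x => φ x ^ 2 * u x := by
  exact ((hφ.1.continuous.pow 2).mul hu).integrable_of_hasCompactSupport
    hφ.hasCompactSupport_sq.mul_right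

theorem IsTest.integrable_norm_gradient_sq_mul {φ : E n → ℝ} (hφ : IsTest φ) {u : E n → ℝ}
    (hu : Continuous u) : Integrable fun x => ‖gradient φ x‖ ^ 2 * u x := by
  exact ((hφ.continuous_gradient.norm.pow 2).mul hu).integrable_of_hasCompactSupport
    hφ.hasCompactSupport_norm_gradient_sq.mul_right

theorem sq_sum_mul_gradient_le {φ : E n → ℝ} (S : Finset (Fin n)) (x : E n) :
    (∑ i ∈ S, x i * gradient φ x i) ^ 2 ≤ sqOn S x * ‖gradient φ x‖ ^ 2 :=
  (Finset.sum_mul_sq_le_sq_mul_sq S _ _).trans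
    (mul_le_mul_of_nonneg_left (sqOn_le_norm_sq S (gradient φ x)) (sqOn_nonneg S x))

/-- A pointwise lower bound for the divergence of `φ² X`, with `X` the field of
`IsTest.integral_sq_mul_div`, yields a weighted Hardy inequality, as that divergence has
integral zero. -/
theorem IsTest.integral_le_of_div {φ : E n → ℝ} (hφ : IsTest φ) (S : Finset (Fin n)) (b c : ℝ)
    {d : ℝ} (hd : 0 < d) {u w : E n → ℝ} (hu : Continuous u) (hw : Continuous w)
    (h : ∀ x, φ x ^ 2 * u x - ‖gradient φ x‖ ^ 2 * w x ≤
      φ x ^ 2 * (S.card * (japSq x ^ b * (d + sqOn S x) ^ c)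
        + 2 * b * (japSq x ^ (b - 1) * (d + sqOn S x) ^ c * sqOn S x)
        + 2 * c * (japSq x ^ b * (d + sqOn S x) ^ (c - 1) * sqOn S x)) +
      2 * φ x * (japSq x ^ b * (d + sqOn S x) ^ c) * ∑ i ∈ S, x i * gradient φ x i) :
    ∫ x, φ x ^ 2 * u x ≤ ∫ x, ‖gradient φ x‖ ^ 2 * w x := by
  have hpos : ∀ x : E n, 0 < d + sqOn S x := fun x => by linarith [sqOn_nonneg S x]
  have hs : Continuous (sqOn S : E n → ℝ) := (contDiff_sqOn (m := 0) S).continuous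
  have hR : ∀ e : ℝ, Continuous fun x : E n => (d + sqOn S x) ^ e := fun e =>
    (continuous_const.add hs).rpow_const fun x => Or.inl (hpos x).ne'
  have hq := fun e : ℝ => continuous_japSq_rpow (n := n) e
  have hF := hφ.integrable_sq_mul (u := fun x => S.card * (japSq x ^ b * (d + sqOn S x) ^ c)
        + 2 * b * (japSq x ^ (b - 1) * (d + sqOn S x) ^ c * sqOn S x)
        + 2 * c * (japSq x ^ b * (d + sqOn S x) ^ (c - 1) * sqOn S x))
    (((continuous_const.mul ((hq b).mul (hR c))).add
      (continuous_const.mul (((hq (b - 1)).mul (hR c)).mul hs))).add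
      (continuous_const.mul (((hq b).mul (hR (c - 1))).mul hs)))
  have hG : Integrable fun x => 2 * φ x * (japSq x ^ b * (d + sqOn S x) ^ c) *
      ∑ i ∈ S, x i * gradient φ x i := by
    refine (((continuous_const.mul hφ.1.continuous).mul ((hq b).mul (hR c))).mul
      (continuous_finsetSum S fun i _ => ?_)).integrable_of_hasCompactSupport ?_
    · exact (contDiff_coord (m := 0) i).continuous.mul
        ((contDiff_coord (m := 0) i).continuous.comp hφ.continuous_gradient)
    · exact ((hφ.2.mul_left (f := fun _ => (2:ℝ))).mul_right).mul_right
  have h0 := hφ.integral_sq_mul_div S b c hd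
  have hU := hφ.integrable_sq_mul hu
  have hW := hφ.integrable_norm_gradient_sq_mul hw
  have := integral_mono (hU.sub hW) (hF.add hG) h
  simp only [Pi.add_apply, Pi.sub_apply] at this
  rw [integral_sub hU hW, integral_add hF hG, h0] at this
  linarith

/-- The Hardy inequality `∫ ⟨x⟩^{2β-2} φ² ≤ C ∫ ⟨x⟩^{2β} |Dφ|²`, valid for `2β > 2 - n`. It comes
from the field `⟨x⟩^{2β-2} x`. -/
theorem exists_hardy {β : ℝ} (hn : 0 < n) (hβ : 0 < (n : ℝ) + 2 * β - 2) :
    ∃ C : ℝ, 0 < C ∧ ∀ φ : E n → ℝ, IsTest φ →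
      ∫ x, φ x ^ 2 * japSq x ^ (β - 1) ≤ C * ∫ x, ‖gradient φ x‖ ^ 2 * japSq x ^ β := by
  have hn' : (0 : ℝ) < n := by exact_mod_cast hn
  obtain ⟨κ, hκ, hκ1, hκ2⟩ : ∃ κ : ℝ, 0 < κ ∧ κ ≤ n ∧ κ ≤ (n : ℝ) + 2 * (β - 1) :=
    ⟨min n ((n : ℝ) + 2 * (β - 1)), lt_min hn' (by linarith), min_le_left _ _, min_le_right _ _⟩
  refine ⟨(κ / 2)⁻¹ * (2 / κ), by positivity, fun φ hφ => ?_⟩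
  have key := hφ.integral_le_of_div Finset.univ (β - 1) 0 one_pos
    (u := fun x => κ / 2 * japSq x ^ (β - 1)) (w := fun x => 2 / κ * japSq x ^ β)
    (continuous_const.mul (continuous_japSq_rpow _))
    (continuous_const.mul (continuous_japSq_rpow _)) (fun x => ?_)
  · simp only [mul_left_comm _ (κ / 2), mul_left_comm _ (2 / κ), integral_const_mul] at key
    rw [mul_assoc, inv_mul_eq_div, le_div_iff₀ (by positivity), mul_comm]
    exact key
  · have hq := japSq_pos x
    have hT := sq_sum_mul_gradient_le (φ := φ) Finset.univ x
    set T := ∑ i, x i * gradient φ x i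
    have e1 : japSq x ^ β = japSq x ^ (β - 1) * japSq x := by
      rw [← Real.rpow_add_one hq.ne']; ring_nf
    have e2 : japSq x ^ (β - 1) = japSq x ^ (β - 1 - 1) * japSq x := by
      rw [← Real.rpow_add_one hq.ne']; ring_nf
    have hg : 0 ≤ ‖gradient φ x‖ ^ 2 := sq_nonneg _
    rw [sqOn_univ] at *
    have hxq : ‖x‖ ^ 2 = japSq x - 1 := by simp [japSq]
    have hx0 : 0 ≤ ‖x‖ ^ 2 := sq_nonneg _
    simp only [Real.rpow_zero, mul_one, mul_zero, zero_mul, add_zero, Finset.card_univ,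
      Fintype.card_fin]
    have hP : 0 < japSq x ^ (β - 1 - 1) := Real.rpow_pos_of_pos hq _
    set P := japSq x ^ (β - 1 - 1)
    have hT' : T ^ 2 ≤ japSq x * ‖gradient φ x‖ ^ 2 :=
      hT.trans (mul_le_mul_of_nonneg_right (by linarith) hg)
    have hdiv : κ * japSq x ≤ n * japSq x + 2 * (β - 1) * ‖x‖ ^ 2 := by
      have : n * japSq x + 2 * (β - 1) * ‖x‖ ^ 2 - κ * japSq x
        = (n + 2 * (β - 1) - κ) * ‖x‖ ^ 2 + (n - κ) := by rw [hxq]; ring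
      have : 0 ≤ (n + 2 * (β - 1) - κ) * ‖x‖ ^ 2 := mul_nonneg (by linarith) hx0
      linarith
    have h1 : P * φ x ^ 2 * (κ * japSq x) ≤
        P * φ x ^ 2 * (n * japSq x + 2 * (β - 1) * ‖x‖ ^ 2) :=
      mul_le_mul_of_nonneg_left hdiv (by positivity)
    have h2 : 0 ≤ κ / 2 * φ x ^ 2 + 2 * φ x * T + 2 / κ * T ^ 2 := by
      have : κ / 2 * φ x ^ 2 + 2 * φ x * T + 2 / κ * T ^ 2 = κ / 2 * (φ x + 2 / κ * T) ^ 2 := by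
        field_simp; ring
      rw [this]; positivity
    have h3 : 2 / κ * T ^ 2 ≤ 2 / κ * (japSq x * ‖gradient φ x‖ ^ 2) :=
      mul_le_mul_of_nonneg_left hT' (by positivity)
    have h4 : 0 ≤ P * japSq x * (κ / 2 * φ x ^ 2 + 2 * φ x * T
        + 2 / κ * (japSq x * ‖gradient φ x‖ ^ 2)) :=
      mul_nonneg (by positivity) (by linarith)
    rw [e1, e2]
    nlinarith [h1, h4]

/-- The field `⟨x⟩^{2β-2} y / (d + |y|²)^{1/2}` controls the weight `|y|⁻¹ ⟨x⟩^{2β-2}` by a small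
multiple of the Dirichlet integral and the lower order weight `⟨x⟩^{2β-3}`. -/
theorem IsTest.integral_singular_le {φ : E n → ℝ} (hφ : IsTest φ) {S : Finset (Fin n)}
    (hS : 2 ≤ S.card) (β : ℝ) {d η : ℝ} (hd : 0 < d) (hη : 0 < η) :
    ∫ x, φ x ^ 2 * (japSq x ^ (β - 1) * (d + sqOn S x) ^ (-(1 / 2) : ℝ)) ≤
      η * (∫ x, ‖gradient φ x‖ ^ 2 * japSq x ^ β) +
        (2 * |β - 1| + 1 / η) * ∫ x, φ x ^ 2 * japSq x ^ (β - 3 / 2) := by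
  have hpos : ∀ x : E n, 0 < d + sqOn S x := fun x => by linarith [sqOn_nonneg S x]
  have hs : Continuous (sqOn S : E n → ℝ) := (contDiff_sqOn (m := 0) S).continuous
  have hR : Continuous fun x : E n => japSq x ^ (β - 1) * (d + sqOn S x) ^ (-(1 / 2) : ℝ) :=
    (continuous_japSq_rpow _).mul
      ((continuous_const.add hs).rpow_const fun x => Or.inl (hpos x).ne')
  have key := hφ.integral_le_of_div S (β - 1) (-(1 / 2)) hd
    (u := fun x => japSq x ^ (β - 1) * (d + sqOn S x) ^ (-(1 / 2) : ℝ)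
      - (2 * |β - 1| + 1 / η) * japSq x ^ (β - 3 / 2)) (w := fun x => η * japSq x ^ β)
    (hR.sub (continuous_const.mul (continuous_japSq_rpow _)))
    (continuous_const.mul (continuous_japSq_rpow _)) (fun x => ?_)
  · simp only [mul_sub, mul_left_comm _ (2 * |β - 1| + 1 / η), mul_left_comm _ η] at key
    rw [integral_sub (hφ.integrable_sq_mul hR)
      ((hφ.integrable_sq_mul (continuous_japSq_rpow _)).const_mul _), integral_const_mul,
      integral_const_mul] at key
    linarith
  · have hq := japSq_pos x
    have hq1 := one_le_japSq x
    have hT := sq_sum_mul_gradient_le (φ := φ) S x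
    have hRx := hpos x
    have hs0 := sqOn_nonneg S x
    have hsx := sqOn_le_norm_sq S x
    set T := ∑ i ∈ S, x i * gradient φ x i
    have hxq : ‖x‖ ^ 2 = japSq x - 1 := by simp [japSq]
    have e0 : japSq x ^ (β - 3 / 2) = japSq x ^ (β - 1 - 1) * japSq x ^ (1 / 2 : ℝ) := by
      rw [← Real.rpow_add hq]; ring_nf
    have e2 : japSq x ^ (β - 1) = japSq x ^ (β - 1 - 1) * japSq x := by
      rw [← Real.rpow_add_one hq.ne']; ring_nf
    have e1 : japSq x ^ β = japSq x ^ (β - 1 - 1) * japSq x ^ 2 := by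
      rw [← Real.rpow_natCast, ← Real.rpow_add hq]; congr 1; push_cast; ring
    have e3 : (d + sqOn S x) ^ (-(1 / 2) - 1 : ℝ)
        = (d + sqOn S x) ^ (-(1 / 2) : ℝ) / (d + sqOn S x) := by
      rw [Real.rpow_sub_one hRx.ne']
    have e4 : ((d + sqOn S x) ^ (-(1 / 2) : ℝ)) ^ 2 * (d + sqOn S x) = 1 := by
      rw [← Real.rpow_natCast, ← Real.rpow_mul hRx.le, ← Real.rpow_add_one hRx.ne']; norm_num
    have e5 : (japSq x ^ (1 / 2 : ℝ)) ^ 2 = japSq x := by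
      rw [← Real.rpow_natCast, ← Real.rpow_mul hq.le]; norm_num
    have hP : 0 < japSq x ^ (β - 1 - 1) := Real.rpow_pos_of_pos hq _
    have hr : 0 < (d + sqOn S x) ^ (-(1 / 2) : ℝ) := Real.rpow_pos_of_pos hRx _
    have hh : 1 ≤ japSq x ^ (1 / 2 : ℝ) := Real.one_le_rpow hq1 (by norm_num)
    rw [e0, e1, e2, e3]
    set P := japSq x ^ (β - 1 - 1)
    set r := (d + sqOn S x) ^ (-(1 / 2) : ℝ)
    set h := japSq x ^ (1 / 2 : ℝ)
    set g := ‖gradient φ x‖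
    set f := φ x
    set y := sqOn S x
    set Q := japSq x
    -- `r |y|² ≤ ⟨x⟩`
    have h1 : r * y ≤ h := by
      have : (r * y) ^ 2 ≤ h ^ 2 := by
        rw [e5]
        have : (r * y) ^ 2 ≤ y := by
          have : (r * y) ^ 2 = y * (r ^ 2 * y) := by ring
          have h' : r ^ 2 * y ≤ 1 := by nlinarith [sq_nonneg r]
          rw [this]; nlinarith
        linarith
      exact le_of_sq_le_sq this (by linarith)
    have h2 : (r * T) ^ 2 ≤ g ^ 2 := by
      have h' : r ^ 2 * y ≤ 1 := by nlinarith [sq_nonneg r]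
      calc (r * T) ^ 2 = r ^ 2 * T ^ 2 := by ring
        _ ≤ r ^ 2 * (y * g ^ 2) := mul_le_mul_of_nonneg_left hT (sq_nonneg r)
        _ = (r ^ 2 * y) * g ^ 2 := by ring
        _ ≤ 1 * g ^ 2 := mul_le_mul_of_nonneg_right h' (sq_nonneg g)
        _ = g ^ 2 := one_mul _
    have h3 : y / (d + y) ≤ 1 := by rw [div_le_one hRx]; linarith
    have h4 : (2 : ℝ) ≤ S.card := by exact_mod_cast hS
    have a1 : f ^ 2 * P * Q * r * 1 ≤ f ^ 2 * P * Q * r * (S.card - y / (d + y)) :=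
      mul_le_mul_of_nonneg_left (by linarith) (by positivity)
    have a2 : -(f ^ 2 * P * (2 * |β - 1| * h)) ≤ f ^ 2 * P * (2 * (β - 1) * (r * y)) := by
      have b1 : |β - 1| * (r * y) ≤ |β - 1| * h := mul_le_mul_of_nonneg_left h1 (abs_nonneg _)
      have b2 : -|β - 1| * (r * y) ≤ (β - 1) * (r * y) :=
        mul_le_mul_of_nonneg_right (neg_abs_le _) (by positivity)
      have : 0 ≤ f ^ 2 * P * (2 * (β - 1) * (r * y) + 2 * |β - 1| * h) :=
        mul_nonneg (by positivity) (by linarith)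
      linarith
    have a3 : 0 ≤ P * (1 / η * h * f ^ 2 + 2 * f * Q * (r * T) + η * Q ^ 2 * g ^ 2) := by
      refine mul_nonneg hP.le ?_
      have b1 : 1 / η * f ^ 2 ≤ 1 / η * h * f ^ 2 := by
        have : 0 ≤ 1 / η * f ^ 2 * (h - 1) := mul_nonneg (by positivity) (by linarith)
        linarith
      have b2 : η * Q ^ 2 * (r * T) ^ 2 ≤ η * Q ^ 2 * g ^ 2 :=
        mul_le_mul_of_nonneg_left h2 (by positivity)
      have b3 : 1 / η * f ^ 2 + 2 * f * Q * (r * T) + η * Q ^ 2 * (r * T) ^ 2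
          = 1 / η * (f + η * Q * (r * T)) ^ 2 := by field_simp; ring
      have : 0 ≤ 1 / η * (f + η * Q * (r * T)) ^ 2 := by positivity
      linarith
    have e6 : f ^ 2 * (S.card * (P * Q * r) + 2 * (β - 1) * (P * r * y)
          + 2 * (-(1 / 2)) * (P * Q * (r / (d + y)) * y)) + 2 * f * (P * Q * r) * T
        = f ^ 2 * P * Q * r * (S.card - y / (d + y)) + f ^ 2 * P * (2 * (β - 1) * (r * y))
          + P * (2 * f * Q * (r * T)) := by ring
    rw [e6]
    linarith

/-- Far out `⟨x⟩^{2β-3}` is much smaller than `⟨x⟩^{2β-2}`. -/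
theorem exists_tail_le (β : ℝ) {τ : ℝ} (hτ : 0 < τ) :
    ∃ C R : ℝ, 0 < C ∧ ∀ φ : E n → ℝ, IsTest φ →
      ∫ x, φ x ^ 2 * japSq x ^ (β - 3 / 2) ≤
        τ * (∫ x, φ x ^ 2 * japSq x ^ (β - 1)) + C * ∫ x in Metric.ball 0 R, φ x ^ 2 := by
  obtain ⟨C, hC⟩ := (isCompact_closedBall (0 : E n) τ⁻¹).exists_bound_of_continuousOn
    (continuous_japSq_rpow (n := n) (β - 3 / 2)).continuousOn
  refine ⟨max C 1, τ⁻¹, by positivity, fun φ hφ => ?_⟩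
  have hi : Integrable fun x => φ x ^ 2 := by
    simpa using hφ.integrable_sq_mul (u := fun _ => 1) continuous_const
  rw [← integral_indicator Metric.isOpen_ball.measurableSet, ← integral_const_mul,
    ← integral_const_mul, ← integral_add
      ((hφ.integrable_sq_mul (continuous_japSq_rpow _)).const_mul _)
      ((hi.indicator Metric.isOpen_ball.measurableSet).const_mul _)]
  refine integral_mono (hφ.integrable_sq_mul (continuous_japSq_rpow _))
    (((hφ.integrable_sq_mul (continuous_japSq_rpow _)).const_mul _).add
      ((hi.indicator Metric.isOpen_ball.measurableSet).const_mul _)) fun x => ?_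
  have hq := japSq_pos x
  have hp : 0 < japSq x ^ (β - 1) := Real.rpow_pos_of_pos hq _
  by_cases hx : x ∈ Metric.ball (0 : E n) τ⁻¹
  · simp only [Set.indicator_of_mem hx]
    have h1 := (le_abs_self _).trans (hC x (Metric.ball_subset_closedBall hx))
    have h2 : japSq x ^ (β - 3 / 2) ≤ max C 1 := h1.trans (le_max_left _ _)
    have := mul_le_mul_of_nonneg_left h2 (sq_nonneg (φ x))
    have : 0 ≤ τ * (φ x ^ 2 * japSq x ^ (β - 1)) := by positivity
    linarith
  · simp only [Set.indicator_of_notMem hx, mul_zero, add_zero]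
    have hx' : τ⁻¹ ≤ ‖x‖ := by simpa using hx
    have e0 : japSq x ^ (β - 1) = japSq x ^ (β - 3 / 2) * japSq x ^ (1 / 2 : ℝ) := by
      rw [← Real.rpow_add hq]; congr 1; ring
    have h1 : ‖x‖ ≤ japSq x ^ (1 / 2 : ℝ) := by
      rw [← Real.sqrt_eq_rpow]
      exact Real.le_sqrt_of_sq_le (by simp [japSq])
    have h2 : 1 ≤ τ * japSq x ^ (1 / 2 : ℝ) := by
      have := mul_le_mul_of_nonneg_left (hx'.trans h1) hτ.le
      rwa [mul_inv_cancel₀ hτ.ne'] at this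
    rw [e0]
    have : 0 ≤ φ x ^ 2 * japSq x ^ (β - 3 / 2) := by positivity
    nlinarith

/-- The weighted mass is bounded by a small multiple of the Dirichlet integral and the unweighted
mass in a ball. The left side is a `lintegral`, so that the integrability of its integrand is part
of the claim. -/
theorem exists_lintegral_mass_le {β : ℝ} (hn : 0 < n) (hβ : 0 < (n : ℝ) + 2 * β - 2)
    {S : Finset (Fin n)} (hS : 2 ≤ S.card) {ε : ℝ} (hε : 0 < ε) :
    ∃ C R : ℝ, 0 < C ∧ ∀ φ : E n → ℝ, IsTest φ →
      ∫⁻ x, ENNReal.ofReal (φ x ^ 2 * (japSq x ^ (β - 1) * (√(sqOn S x))⁻¹)) ≤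
        ENNReal.ofReal (ε * (∫ x, ‖gradient φ x‖ ^ 2 * japSq x ^ β) +
          C * ∫ x in Metric.ball 0 R, φ x ^ 2) := by
  obtain ⟨A, hA, hhardy⟩ := exists_hardy hn hβ
  set η := ε / 2 with hηdef
  have hη : 0 < η := by positivity
  set B := 2 * |β - 1| + 1 / η with hB
  have hBpos : 0 < B := by positivity
  obtain ⟨C, R, hC, htail⟩ := exists_tail_le (n := n) β (τ := ε / 2 / (A * B)) (by positivity)
  refine ⟨B * C, R, by positivity, fun φ hφ => ?_⟩
  set D := ∫ x, ‖gradient φ x‖ ^ 2 * japSq x ^ β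
  have hbound : ∀ d : ℝ, 0 < d →
      ∫ x, φ x ^ 2 * (japSq x ^ (β - 1) * (d + sqOn S x) ^ (-(1 / 2) : ℝ)) ≤
        ε * D + B * C * ∫ x in Metric.ball 0 R, φ x ^ 2 := by
    intro d hd
    have h1 := hφ.integral_singular_le hS β hd hη
    have h2 := mul_le_mul_of_nonneg_left (htail φ hφ) hBpos.le
    have h3 : B * (ε / 2 / (A * B)) * (∫ x, φ x ^ 2 * japSq x ^ (β - 1))
        ≤ B * (ε / 2 / (A * B)) * (A * D) :=
      mul_le_mul_of_nonneg_left (hhardy φ hφ) (by positivity)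
    have h4 : B * (ε / 2 / (A * B)) * (A * D) = ε / 2 * D := by field_simp
    have h5 : B * (ε / 2 / (A * B) * (∫ x, φ x ^ 2 * japSq x ^ (β - 1)) +
        C * ∫ x in Metric.ball 0 R, φ x ^ 2) = B * (ε / 2 / (A * B)) *
          (∫ x, φ x ^ 2 * japSq x ^ (β - 1)) + B * C * ∫ x in Metric.ball 0 R, φ x ^ 2 := by ring
    have h6 : η * D = ε / 2 * D := rfl
    rw [← hB] at h1
    linarith
  have hs : Continuous (sqOn S : E n → ℝ) := (contDiff_sqOn (m := 0) S).continuous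
  -- remove the regularization `d = 1 / (m + 1)` by Fatou's lemma
  let F : ℕ → E n → ENNReal := fun m x => ENNReal.ofReal
    (φ x ^ 2 * (japSq x ^ (β - 1) * (1 / ((m : ℝ) + 1) + sqOn S x) ^ (-(1 / 2) : ℝ)))
  have hcont : ∀ m : ℕ, Continuous fun x : E n =>
      japSq x ^ (β - 1) * (1 / ((m : ℝ) + 1) + sqOn S x) ^ (-(1 / 2) : ℝ) := fun m =>
    (continuous_japSq_rpow _).mul ((continuous_const.add hs).rpow_const fun x =>
      Or.inl (add_pos_of_pos_of_nonneg (by positivity) (sqOn_nonneg S x)).ne')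
  have hF : ∀ m, ∫⁻ x, F m x ≤
      ENNReal.ofReal (ε * D + B * C * ∫ x in Metric.ball 0 R, φ x ^ 2) := by
    intro m
    rw [← ofReal_integral_eq_lintegral_ofReal (hφ.integrable_sq_mul (hcont m))
      (Filter.Eventually.of_forall fun x => ?_)]
    · exact ENNReal.ofReal_le_ofReal (hbound _ (by positivity))
    · have h1 := japSq_pos x
      have h2 := sqOn_nonneg S x
      simp only [Pi.zero_apply]
      positivity
  calc _ ≤ ∫⁻ x, Filter.liminf (fun m => F m x) Filter.atTop := lintegral_mono fun x => ?_
    _ ≤ Filter.liminf (fun m => ∫⁻ x, F m x) Filter.atTop := lintegral_liminf_le fun m =>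
        (((hφ.1.continuous.pow 2).mul (hcont m)).measurable.ennreal_ofReal)
    _ ≤ _ := Filter.liminf_le_of_le (by isBoundedDefault) fun b hb => by
        obtain ⟨m, hm⟩ := hb.exists
        exact hm.trans (hF m)
  rcases (sqOn_nonneg S x).eq_or_lt with h0 | h0
  -- where `sqOn S x = 0`, the inverse on the left is `0`
  · simp [← h0]
  · refine ge_of_eq (Filter.Tendsto.liminf_eq ?_)
    refine ENNReal.tendsto_ofReal (Filter.Tendsto.const_mul _ (Filter.Tendsto.const_mul _ ?_))
    have e : (√(sqOn S x))⁻¹ = (0 + sqOn S x) ^ (-(1 / 2) : ℝ) := by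
      rw [zero_add, Real.rpow_neg h0.le, Real.sqrt_eq_rpow]
    rw [e]
    exact (tendsto_one_div_add_atTop_nhds_zero_nat.add_const _).rpow_const
      (Or.inl (by simpa using h0.ne'))

end WeightedHardy

/-! ### The Poincaré inequality on convex sets -/

section Poincare

variable {n : ℕ}

/-- The fundamental theorem of calculus on a segment, with the Cauchy–Schwarz inequality. -/
theorem IsTest.ofReal_sq_sub_le {φ : E n → ℝ} (hφ : IsTest φ) (x y : E n) :
    ENNReal.ofReal ((φ x - φ y) ^ 2) ≤ ENNReal.ofReal (dist x y ^ 2) *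
      ∫⁻ t in Set.Icc (0 : ℝ) 1, ENNReal.ofReal (‖gradient φ (x + t • (y - x))‖ ^ 2) := by
  have hline : Continuous fun t : ℝ => x + t • (y - x) := by fun_prop
  set g : ℝ → ℝ := fun t => fderiv ℝ φ (x + t • (y - x)) (y - x) with hg
  have hgc : Continuous g := ((hφ.1.continuous_fderiv (by simp)).comp hline).clm_apply
    continuous_const
  have hder : ∀ t : ℝ, HasDerivAt (fun t : ℝ => φ (x + t • (y - x))) (g t) t := by
    intro t
    have h1 : HasDerivAt (fun t : ℝ => x + t • (y - x)) (y - x) t := by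
      simpa using ((hasDerivAt_id t).smul_const (y - x)).const_add x
    exact (hφ.differentiable _).hasFDerivAt.comp_hasDerivAt t h1
  have hftc : ∫ t in (0 : ℝ)..1, g t = φ y - φ x := by
    rw [intervalIntegral.integral_eq_sub_of_hasDerivAt (fun t _ => hder t)
      (hgc.intervalIntegrable _ _)]
    simp
  set c := φ y - φ x
  have hi1 : IntervalIntegrable g volume 0 1 := hgc.intervalIntegrable _ _
  have hi2 : IntervalIntegrable (fun t => g t ^ 2) volume 0 1 := (hgc.pow 2).intervalIntegrable _ _
  have hsq : c ^ 2 ≤ ∫ t in (0 : ℝ)..1, g t ^ 2 := by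
    have h0 : 0 ≤ ∫ t in (0 : ℝ)..1, (g t - c) ^ 2 :=
      intervalIntegral.integral_nonneg zero_le_one fun t _ => sq_nonneg _
    have h1 : ∫ t in (0 : ℝ)..1, (g t - c) ^ 2 = (∫ t in (0 : ℝ)..1, g t ^ 2) - c ^ 2 := by
      have : ∀ t, (g t - c) ^ 2 = g t ^ 2 - 2 * c * g t + c ^ 2 := fun t => by ring
      simp only [this]
      rw [intervalIntegral.integral_add (hi2.sub (hi1.const_mul _)) (by simp),
        intervalIntegral.integral_sub hi2 (hi1.const_mul _), intervalIntegral.integral_const_mul,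
        hftc]
      simp
      ring
    linarith
  have hle : ∀ t, g t ^ 2 ≤ dist x y ^ 2 * ‖gradient φ (x + t • (y - x))‖ ^ 2 := by
    intro t
    have := (fderiv ℝ φ (x + t • (y - x))).le_opNorm (y - x)
    rw [← norm_gradient, Real.norm_eq_abs] at this
    rw [dist_comm, dist_eq_norm, ← mul_pow, ← sq_abs, mul_comm]
    gcongr
  have hGc : Continuous fun t : ℝ => ‖gradient φ (x + t • (y - x))‖ ^ 2 :=
    ((hφ.continuous_gradient.comp hline).norm).pow 2
  calc ENNReal.ofReal ((φ x - φ y) ^ 2) = ENNReal.ofReal (c ^ 2) := by congr 1; ring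
    _ ≤ ENNReal.ofReal (∫ t in (0 : ℝ)..1, g t ^ 2) := ENNReal.ofReal_le_ofReal hsq
    _ ≤ ENNReal.ofReal (∫ t in Set.Icc (0 : ℝ) 1,
          dist x y ^ 2 * ‖gradient φ (x + t • (y - x))‖ ^ 2) := by
        rw [intervalIntegral.integral_of_le zero_le_one, ← integral_Icc_eq_integral_Ioc]
        refine ENNReal.ofReal_le_ofReal (integral_mono ?_ ?_ hle)
        · exact (hgc.pow 2).integrableOn_Icc
        · exact (continuous_const.mul hGc).integrableOn_Icc
    _ = _ := by
        rw [integral_const_mul, ENNReal.ofReal_mul (sq_nonneg _),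
          ofReal_integral_eq_lintegral_ofReal hGc.integrableOn_Icc
            (Filter.Eventually.of_forall fun t => sq_nonneg _)]

/-- An affine change of variables with ratio `t ≥ 1/2` costs at most the factor `2ⁿ`. -/
theorem lintegral_comp_affine_le (G : E n → ENNReal) (v : E n) {t : ℝ}
    (ht : 1 / 2 ≤ t) : ∫⁻ y, G (v + t • y) ≤ 2 ^ n * ∫⁻ z, G z := by
  have ht0 : 0 < t := by linarith
  have h1 : ∫⁻ y, G (v + t • y) = ∫⁻ z, G (v + z) ∂(Measure.map (fun y : E n => t • y) volume) :=
    ((Homeomorph.smulOfNeZero t ht0.ne').measurableEmbedding.lintegral_map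
      (fun z => G (v + z))).symm
  rw [h1, Measure.map_addHaar_smul volume ht0.ne', lintegral_smul_measure,
    lintegral_add_left_eq_self]
  refine mul_le_mul_left ?_ _
  have : |(t ^ Module.finrank ℝ (E n))⁻¹| ≤ 2 ^ n := by
    rw [finrank_euclideanSpace_fin, abs_of_pos (by positivity), ← inv_pow]
    refine pow_le_pow_left₀ (by positivity) ?_ n
    rw [inv_le_comm₀ ht0 two_pos]; linarith
  calc _ ≤ ENNReal.ofReal (2 ^ n) := ENNReal.ofReal_le_ofReal this
    _ = 2 ^ n := by rw [ENNReal.ofReal_pow zero_le_two]; simp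

/-- For a function supported in `K`, averaging over a point at parameter `t` of the segment
between two points of `K`: of `t` and `1 - t` one is at least `1/2`, and the change of variables
is made in the corresponding endpoint. -/
theorem lintegral_lintegral_segment_le (K : Set (E n))
    {G : E n → ENNReal} (hG : Measurable G) (t : ℝ) :
    ∫⁻ x in K, ∫⁻ y in K, G (x + t • (y - x)) ≤ 2 ^ n * volume K * ∫⁻ z, G z := by
  have hconst : ∫⁻ _ in K, 2 ^ n * ∫⁻ z, G z = 2 ^ n * volume K * ∫⁻ z, G z := by
    rw [setLIntegral_const]; ring
  rcases le_total (1 / 2) t with ht | ht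
  · rw [← hconst]
    refine lintegral_mono fun x => (setLIntegral_le_lintegral _ _).trans ?_
    have : ∀ y : E n, x + t • (y - x) = (x - t • x) + t • y := fun y => by
      rw [smul_sub]; abel
    simp only [this]
    exact lintegral_comp_affine_le G _ ht
  · rw [lintegral_lintegral_swap (by fun_prop), ← hconst]
    refine lintegral_mono fun y => (setLIntegral_le_lintegral _ _).trans ?_
    have : ∀ x : E n, x + t • (y - x) = t • y + (1 - t) • x := fun x => by
      rw [smul_sub, sub_smul, one_smul]; abel
    simp only [this]
    exact lintegral_comp_affine_le G _ (by linarith)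

/-- The Poincaré inequality on a convex set of diameter at most `h`, with a constant that does not
depend on the set otherwise. -/
theorem IsTest.setIntegral_sq_le {φ : E n → ℝ} (hφ : IsTest φ) {K : Set (E n)}
    (hK : MeasurableSet K) (hconv : Convex ℝ K) (hfin : volume K ≠ ⊤) {h : ℝ}
    (hdiam : ∀ x ∈ K, ∀ y ∈ K, dist x y ≤ h) :
    ∫ x in K, φ x ^ 2 ≤ (volume.real K)⁻¹ * (∫ x in K, φ x) ^ 2
      + 2 ^ n * h ^ 2 * ∫ x in K, ‖gradient φ x‖ ^ 2 := by
  have : IsFiniteMeasure (volume.restrict K) := ⟨by simpa using hfin.lt_top⟩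
  rcases eq_or_ne (volume K) 0 with h0 | h0
  · have : volume.restrict K = 0 := Measure.restrict_eq_zero.2 h0
    simp [this]
  have hV : 0 < volume.real K := ENNReal.toReal_pos h0 hfin
  have hi1 : Integrable φ (volume.restrict K) :=
    (hφ.1.continuous.integrable_of_hasCompactSupport hφ.2).restrict
  have hi2 : Integrable (fun x => φ x ^ 2) (volume.restrict K) := by
    have := (hφ.integrable_sq_mul (u := fun _ => 1) continuous_const).restrict (s := K)
    simpa using this
  have hi3 : Integrable (fun x => ‖gradient φ x‖ ^ 2) (volume.restrict K) := by
    have := (hφ.integrable_norm_gradient_sq_mul (u := fun _ => 1) continuous_const).restrict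
      (s := K)
    simpa using this
  set V := volume.real K
  set I := ∫ x in K, φ x
  set J := ∫ x in K, φ x ^ 2
  set D := ∫ x in K, ‖gradient φ x‖ ^ 2
  -- the double integral of `(φ x - φ y) ^ 2` over `K × K` equals `2 * (V * J - I ^ 2)`
  have hexp : ∀ x, (fun y => (φ x - φ y) ^ 2) = fun y => φ x ^ 2 - 2 * φ x * φ y + φ y ^ 2 :=
    fun x => by ext y; ring
  have hinner_i : ∀ x, Integrable (fun y => (φ x - φ y) ^ 2) (volume.restrict K) := fun x => by
    rw [hexp]; exact ((integrable_const _).sub (hi1.const_mul _)).add hi2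
  have hinner : ∀ x, ∫ y in K, (φ x - φ y) ^ 2 = V * φ x ^ 2 - 2 * I * φ x + J := by
    intro x
    have h12 : Integrable (fun y => φ x ^ 2 - 2 * φ x * φ y) (volume.restrict K) :=
      (integrable_const _).sub (hi1.const_mul _)
    rw [hexp, integral_add h12 hi2,
      integral_sub (integrable_const _) (hi1.const_mul _), integral_const_mul]
    simp only [integral_const, measureReal_restrict_apply_univ, smul_eq_mul]
    ring
  have houter_i : Integrable (fun x => V * φ x ^ 2 - 2 * I * φ x + J) (volume.restrict K) :=
    ((hi2.const_mul _).sub (hi1.const_mul _)).add (integrable_const _)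
  have houter : ∫ x in K, (V * φ x ^ 2 - 2 * I * φ x + J) = 2 * (V * J - I ^ 2) := by
    have h12 : Integrable (fun x => V * φ x ^ 2 - 2 * I * φ x) (volume.restrict K) :=
      (hi2.const_mul _).sub (hi1.const_mul _)
    rw [integral_add h12 (integrable_const _),
      integral_sub (hi2.const_mul _) (hi1.const_mul _), integral_const_mul, integral_const_mul]
    simp only [integral_const, measureReal_restrict_apply_univ, smul_eq_mul]
    ring
  have hnn : ∀ x, 0 ≤ V * φ x ^ 2 - 2 * I * φ x + J := fun x => by
    rw [← hinner]; exact integral_nonneg fun y => sq_nonneg _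
  let G : E n → ENNReal := K.indicator fun z => ENNReal.ofReal (‖gradient φ z‖ ^ 2)
  have hG : Measurable G :=
    ((hφ.continuous_gradient.norm.pow 2).measurable.ennreal_ofReal).indicator hK
  have hGint : ∫⁻ z, G z = ENNReal.ofReal D := by
    rw [lintegral_indicator hK, ofReal_integral_eq_lintegral_ofReal hi3
      (Filter.Eventually.of_forall fun _ => sq_nonneg _)]
  have hpt : ∀ x ∈ K, ∀ y ∈ K, ENNReal.ofReal ((φ x - φ y) ^ 2) ≤
      ENNReal.ofReal (h ^ 2) * ∫⁻ t in Set.Icc (0 : ℝ) 1, G (x + t • (y - x)) := by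
    intro x hx y hy
    refine (hφ.ofReal_sq_sub_le x y).trans (mul_le_mul' ?_ ?_)
    · exact ENNReal.ofReal_le_ofReal (pow_le_pow_left₀ dist_nonneg (hdiam x hx y hy) 2)
    · refine setLIntegral_mono' measurableSet_Icc fun t ht => ?_
      have : x + t • (y - x) ∈ K := hconv.add_smul_sub_mem hx hy ht
      simp only [G, Set.indicator_of_mem this, le_refl]
  have hmain : ENNReal.ofReal (2 * (V * J - I ^ 2)) ≤
      ENNReal.ofReal (h ^ 2 * (2 ^ n * V * D)) := by
    have hm : Measurable fun p : (E n × E n) × ℝ => G (p.1.1 + p.2 • (p.1.2 - p.1.1)) := by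
      fun_prop
    calc ENNReal.ofReal (2 * (V * J - I ^ 2))
        = ∫⁻ x in K, ∫⁻ y in K, ENNReal.ofReal ((φ x - φ y) ^ 2) := by
          rw [← houter, ofReal_integral_eq_lintegral_ofReal houter_i
            (Filter.Eventually.of_forall hnn)]
          refine lintegral_congr fun x => ?_
          rw [← hinner, ofReal_integral_eq_lintegral_ofReal (hinner_i x)
            (Filter.Eventually.of_forall fun _ => sq_nonneg _)]
      _ ≤ ∫⁻ x in K, ∫⁻ y in K, ENNReal.ofReal (h ^ 2) *
            ∫⁻ t in Set.Icc (0 : ℝ) 1, G (x + t • (y - x)) :=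
          setLIntegral_mono' hK fun x hx => setLIntegral_mono' hK fun y hy => hpt x hx y hy
      _ = ENNReal.ofReal (h ^ 2) * ∫⁻ x in K, ∫⁻ y in K, ∫⁻ t in Set.Icc (0 : ℝ) 1,
            G (x + t • (y - x)) := by
          simp only [lintegral_const_mul' _ _ ENNReal.ofReal_ne_top]
      _ = ENNReal.ofReal (h ^ 2) * ∫⁻ t in Set.Icc (0 : ℝ) 1, ∫⁻ x in K, ∫⁻ y in K,
            G (x + t • (y - x)) := by
          congr 1
          rw [lintegral_lintegral_swap (μ := volume.restrict (Set.Icc (0 : ℝ) 1))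
            (f := fun t x => ∫⁻ y in K, G (x + t • (y - x)))]
          · refine lintegral_congr fun x => ?_
            exact lintegral_lintegral_swap (by fun_prop)
          · refine (Measurable.lintegral_prod_right' (f := fun p : (ℝ × E n) × E n =>
              G (p.1.2 + p.1.1 • (p.2 - p.1.2))) (by fun_prop)).aemeasurable
      _ ≤ ENNReal.ofReal (h ^ 2) * ∫⁻ _ in Set.Icc (0 : ℝ) 1, 2 ^ n * volume K * ∫⁻ z, G z := by
          gcongr with t
          exact lintegral_lintegral_segment_le K hG t
      _ = ENNReal.ofReal (h ^ 2 * (2 ^ n * V * D)) := by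
          rw [setLIntegral_const, hGint, ENNReal.ofReal_mul (sq_nonneg _),
            ENNReal.ofReal_mul (by positivity), ENNReal.ofReal_mul (by positivity),
            ENNReal.ofReal_pow zero_le_two, ofReal_measureReal hfin]
          simp
  have hD : 0 ≤ D := integral_nonneg fun _ => sq_nonneg _
  have hreal := (ENNReal.ofReal_le_ofReal_iff (by positivity)).1 hmain
  have hpos : 0 ≤ h ^ 2 * (2 ^ n * V * D) := by positivity
  have : V * J ≤ V * (V⁻¹ * I ^ 2 + 2 ^ n * h ^ 2 * D) := by
    rw [mul_add, mul_inv_cancel_left₀ hV.ne']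
    nlinarith
  exact le_of_mul_le_mul_left this hV

end Poincare

/-! ### Compactness in balls -/

section Partition

variable {n : ℕ}

/-- Cubes of a fine grid cut a ball into finitely many convex pieces of small diameter. -/
theorem exists_convex_partition_ball (R : ℝ) {h : ℝ} (hh : 0 < h) :
    ∃ (N : ℕ) (K : Fin N → Set (E n)), (∀ i, MeasurableSet (K i)) ∧ (∀ i, Convex ℝ (K i)) ∧
      (∀ i, ∀ x ∈ K i, ∀ y ∈ K i, dist x y ≤ h) ∧ Pairwise (Function.onFun Disjoint K) ∧
      ⋃ i, K i = Metric.ball (0 : E n) R := by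
  set s := h / (√n + 1) with hs
  have hs0 : 0 < s := by positivity
  set M := ⌈R / s⌉ + 1 with hM
  let ι := Fin n → Finset.Icc (-M) M
  let Q : ι → Set (E n) := fun m => Metric.ball 0 R ∩ ⋂ i : Fin n,
    (fun x : E n => x i) ⁻¹' Set.Ico ((m i : ℤ) * s) (((m i : ℤ) + 1) * s)
  have hmem : ∀ (m : ι) (x : E n), x ∈ Q m ↔ x ∈ Metric.ball 0 R ∧ ∀ i, ⌊x i / s⌋ = (m i : ℤ) := by
    intro m x
    simp only [Q, Set.mem_inter_iff, Set.mem_iInter, Set.mem_preimage, Set.mem_Ico,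
      Int.floor_eq_iff, le_div_iff₀ hs0, div_lt_iff₀ hs0]
  let e := Fintype.equivFin ι
  refine ⟨Fintype.card ι, fun j => Q (e.symm j), fun j => ?_, fun j => ?_, fun j x hx y hy => ?_,
    fun j l hjl => ?_, ?_⟩
  · refine Metric.isOpen_ball.measurableSet.inter (MeasurableSet.iInter fun i => ?_)
    exact (contDiff_coord (m := 0) i).continuous.measurable measurableSet_Ico
  · refine (convex_ball _ _).inter (convex_iInter fun i => ?_)
    exact (convex_Ico _ _).linear_preimage (EuclideanSpace.proj i : E n →L[ℝ] ℝ).toLinearMap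
  · rw [hmem] at hx hy
    have hc : ∀ i, (x i - y i) ^ 2 ≤ s ^ 2 := by
      intro i
      have h1 := Int.abs_sub_lt_one_of_floor_eq_floor ((hx.2 i).trans (hy.2 i).symm)
      rw [← sub_div, abs_div, abs_of_pos hs0, div_lt_one hs0] at h1
      exact sq_le_sq' (by linarith [neg_abs_le (x i - y i)]) ((le_abs_self _).trans h1.le)
    have h2 : dist x y ^ 2 ≤ (√n * s) ^ 2 := by
      rw [EuclideanSpace.dist_eq, Real.sq_sqrt (Finset.sum_nonneg fun i _ => sq_nonneg _), mul_pow,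
        Real.sq_sqrt (Nat.cast_nonneg n)]
      simp only [Real.dist_eq, sq_abs]
      calc _ ≤ ∑ _ : Fin n, s ^ 2 := Finset.sum_le_sum fun i _ => hc i
        _ = _ := by simp
    have h3 : dist x y ≤ √n * s := le_of_sq_le_sq h2 (by positivity)
    have h4 : √n * s ≤ h := by
      have : (√n + 1) * s = h := by rw [hs]; field_simp
      nlinarith
    exact h3.trans h4
  · refine Set.disjoint_left.2 fun x hx hy => hjl (e.symm.injective ?_)
    rw [hmem] at hx hy
    funext i
    exact Subtype.ext ((hx.2 i).symm.trans (hy.2 i))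
  · ext x
    simp only [Set.mem_iUnion, hmem]
    refine ⟨fun ⟨_, hx, _⟩ => hx, fun hx => ?_⟩
    have hb : ∀ i, ⌊x i / s⌋ ∈ Finset.Icc (-M) M := by
      intro i
      have h1 : |x i| ≤ R := by
        have := PiLp.norm_apply_le x i
        rw [Real.norm_eq_abs] at this
        exact this.trans (mem_ball_zero_iff.1 hx).le
      have h2 : |x i / s| ≤ R / s := by
        rw [abs_div, abs_of_pos hs0]; gcongr
      have h3 := abs_le.1 (h2.trans (Int.le_ceil _))
      rw [Finset.mem_Icc, Int.le_floor, hM]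
      constructor
      · push_cast; linarith
      · have : (⌊x i / s⌋ : ℝ) ≤ ⌈R / s⌉ := (Int.floor_le _).trans h3.2
        have : ⌊x i / s⌋ ≤ ⌈R / s⌉ := by exact_mod_cast this
        linarith
    exact ⟨e fun i => ⟨_, hb i⟩, hx, fun i => by simp⟩

/-- Up to a small multiple of the Dirichlet integral, the mass in a ball is controlled by finitely
many averages. This is the Rellich compactness theorem in quantitative form. -/
theorem exists_setIntegral_ball_sq_le (R : ℝ) {ε : ℝ} (hε : 0 < ε) :
    ∃ (N : ℕ) (K : Fin N → Set (E n)), (∀ i, K i ⊆ Metric.ball 0 R) ∧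
      ∀ φ : E n → ℝ, IsTest φ → ∫ x in Metric.ball 0 R, φ x ^ 2 ≤
        ε * (∫ x in Metric.ball 0 R, ‖gradient φ x‖ ^ 2)
          + ∑ i, (volume.real (K i))⁻¹ * (∫ x in K i, φ x) ^ 2 := by
  obtain ⟨h, hh, hhε⟩ : ∃ h : ℝ, 0 < h ∧ 2 ^ n * h ^ 2 = ε :=
    ⟨√(ε / 2 ^ n), Real.sqrt_pos.2 (by positivity), by
      rw [Real.sq_sqrt (by positivity)]; field_simp⟩
  obtain ⟨N, K, hm, hc, hd, hdisj, hU⟩ := exists_convex_partition_ball (n := n) R hh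
  have hsub : ∀ i, K i ⊆ Metric.ball 0 R := fun i => hU ▸ Set.subset_iUnion K i
  refine ⟨N, K, hsub, fun φ hφ => ?_⟩
  have hi2 : Integrable fun x => φ x ^ 2 := by
    simpa using hφ.integrable_sq_mul (u := fun _ => 1) continuous_const
  have hi3 : Integrable fun x => ‖gradient φ x‖ ^ 2 := by
    simpa using hφ.integrable_norm_gradient_sq_mul (u := fun _ => 1) continuous_const
  rw [← hU, integral_iUnion_fintype hm hdisj fun i => hi2.integrableOn,
    integral_iUnion_fintype hm hdisj fun i => hi3.integrableOn, Finset.mul_sum,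
    ← Finset.sum_add_distrib]
  refine Finset.sum_le_sum fun i _ => ?_
  have := hφ.setIntegral_sq_le (hm i) (hc i)
    ((measure_mono (hsub i)).trans_lt measure_ball_lt_top).ne (hd i)
  rw [hhε] at this
  linarith

end Partition

/-! ### A compactness criterion -/

/-- A compactness criterion: a bounded operator whose norm is controlled by a finite rank operator
up to an arbitrarily small multiple of the norm of its argument is compact. -/
theorem isCompactOperator_of_norm_le_add_finiteRank {X Y : Type*} [NormedAddCommGroup X]
    [NormedSpace ℝ X] [NormedAddCommGroup Y] [NormedSpace ℝ Y] [CompleteSpace Y] (J : X →L[ℝ] Y)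
    (h : ∀ ε > 0, ∃ (N : ℕ) (F : X →L[ℝ] EuclideanSpace ℝ (Fin N)),
      ∀ x, ‖J x‖ ≤ ε * ‖x‖ + ‖F x‖) : IsCompactOperator J := by
  refine (isCompactOperator_iff_isCompact_closure_image_closedBall J.toLinearMap
    one_pos).2 (TotallyBounded.isCompact_of_isClosed (TotallyBounded.closure ?_) isClosed_closure)
  refine Metric.totallyBounded_iff.2 fun ε hε => ?_
  obtain ⟨N, F, hF⟩ := h (ε / 8) (by positivity)
  have htb : TotallyBounded (F '' Metric.closedBall 0 1) :=
    (F.lipschitz.isBounded_image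
      Metric.isBounded_closedBall).isCompact_closure.totallyBounded.subset subset_closure
  obtain ⟨u, hu, hufin, hcov⟩ := Set.exists_subset_image_finite_and.1
    (totallyBounded_iff_subset.1 htb _ (Metric.dist_mem_uniformity (show 0 < ε / 2 by positivity)))
  refine ⟨J '' u, hufin.image _, ?_⟩
  rintro _ ⟨x, hx, rfl⟩
  obtain ⟨_, ⟨z, hz, rfl⟩, hxz⟩ := Set.mem_iUnion₂.1 (hcov (Set.mem_image_of_mem _ hx))
  refine Set.mem_iUnion₂.2 ⟨_, Set.mem_image_of_mem _ hz, ?_⟩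
  have h1 : ‖x‖ ≤ 1 := by simpa using hx
  have h2 : ‖z‖ ≤ 1 := by simpa using hu hz
  have h3 : ‖F (x - z)‖ < ε / 2 := by
    rw [map_sub, ← dist_eq_norm]; exact hxz
  have h4 : ‖x - z‖ ≤ 2 := (norm_sub_le x z).trans (by linarith)
  have h5 := hF (x - z)
  rw [Metric.mem_ball, dist_eq_norm]
  change ‖J x - J z‖ < ε
  rw [← map_sub]
  nlinarith

/-- The criterion `isCompactOperator_of_norm_le_add_finiteRank` for a linear map on a dense
subspace: it then extends to a compact operator on the completion. -/
theorem exists_compact_extension {X Y : Type*} [SeminormedAddCommGroup X]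
    [NormedSpace ℝ X] [NormedAddCommGroup Y] [NormedSpace ℝ Y] [CompleteSpace Y] (J₀ : X →ₗ[ℝ] Y)
    (h : ∀ ε > 0, ∃ (N : ℕ) (F : X →L[ℝ] EuclideanSpace ℝ (Fin N)),
      ∀ x, ‖J₀ x‖ ≤ ε * ‖x‖ + ‖F x‖) :
    ∃ J : UniformSpace.Completion X →L[ℝ] Y, (∀ x : X, J x = J₀ x) ∧ IsCompactOperator J := by
  have hd : DenseRange (UniformSpace.Completion.toComplL : X →L[ℝ] UniformSpace.Completion X) :=
    UniformSpace.Completion.denseRange_coe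
  have hu : IsUniformInducing
      (UniformSpace.Completion.toComplL : X →L[ℝ] UniformSpace.Completion X) :=
    UniformSpace.Completion.isUniformInducing_coe X
  obtain ⟨N₁, F₁, hF₁⟩ := h 1 one_pos
  let J₁ : X →L[ℝ] Y := J₀.mkContinuous (1 + ‖F₁‖) fun x => by
    have := F₁.le_opNorm x
    have := hF₁ x
    linarith
  have hJ : ∀ x : X, J₁.extend UniformSpace.Completion.toComplL (x : UniformSpace.Completion X)
      = J₀ x := J₁.extend_eq hd hu
  refine ⟨J₁.extend UniformSpace.Completion.toComplL, hJ,
    isCompactOperator_of_norm_le_add_finiteRank _ fun ε hε => ?_⟩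
  obtain ⟨N, F, hF⟩ := h ε hε
  have hFe : ∀ x : X, F.extend UniformSpace.Completion.toComplL (x : UniformSpace.Completion X)
      = F x := F.extend_eq hd hu
  refine ⟨N, F.extend UniformSpace.Completion.toComplL, fun ξ => ?_⟩
  induction ξ using UniformSpace.Completion.induction_on with
  | hp => exact isClosed_le (by fun_prop) (by fun_prop)
  | ih x => rw [hJ, hFe, UniformSpace.Completion.norm_coe]; exact hF x

theorem ofReal_norm_toLp_sq {α V : Type*} {m : MeasurableSpace α} {μ : Measure α}
    [NormedAddCommGroup V] {f : α → V} (hf : MemLp f 2 μ) :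
    ENNReal.ofReal (‖hf.toLp f‖ ^ 2) = ∫⁻ x, ENNReal.ofReal (‖f x‖ ^ 2) ∂μ := by
  have h := eLpNorm_nnreal_pow_eq_lintegral (μ := μ) (f := f) (p := 2) two_ne_zero
  rw [Lp.norm_toLp, ENNReal.ofReal_pow ENNReal.toReal_nonneg, ENNReal.ofReal_toReal hf.2.ne]
  have h2 : ((2 : NNReal) : ℝ) = (2 : ℕ) := by norm_num
  simp only [h2, ENNReal.rpow_natCast] at h
  refine Eq.trans h (lintegral_congr fun x => ?_)
  rw [ENNReal.ofReal_pow (norm_nonneg _), ofReal_norm]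

/-! ### The bounded and compact inclusion for admissible weights -/

section Weights

variable {n : ℕ}

theorem lintegral_weighted {w : E n → ℝ} (hw : Measurable w) {f : E n → ENNReal}
    (hf : Measurable f) : ∫⁻ x, f x ∂(weighted w) = ∫⁻ x, ENNReal.ofReal (w x) * f x :=
  lintegral_withDensity_eq_lintegral_mul _ hw.ennreal_ofReal hf

theorem integral_weighted {w : E n → ℝ} (hw : Measurable w) (h0 : ∀ x, 0 ≤ w x) (f : E n → ℝ) :
    ∫ x, f x ∂(weighted w) = ∫ x, w x * f x := by
  rw [weighted, integral_withDensity_eq_integral_toReal_smul hw.ennreal_ofReal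
    (Filter.Eventually.of_forall fun x => ENNReal.ofReal_lt_top)]
  simp only [ENNReal.toReal_ofReal (h0 _), smul_eq_mul]

/-- A pair of weights `w` and `|x_S|⁻¹ g`, for the Dirichlet integral and for the mass, that are
comparable to `⟨x⟩^{2β}` and `|x_S|⁻¹ ⟨x⟩^{2β-2}` (in the direction that matters for each of them),
where `x_S` is the part of `x` with coordinates in `S`. -/
structure AdmissibleWeights (S : Finset (Fin n)) (β : ℝ) (w g : E n → ℝ) : Prop where
  two_le_card : 2 ≤ S.card
  dim_add_pos : 0 < (n : ℝ) + 2 * β - 2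
  continuous_left : Continuous w
  left_pos : ∀ x, 0 < w x
  le_left : ∃ c : ℝ, 0 < c ∧ ∀ x, c * japSq x ^ β ≤ w x
  continuous_right : Continuous g
  right_pos : ∀ x, 0 < g x
  right_le : ∃ C : ℝ, 0 < C ∧ ∀ x, g x ≤ C * japSq x ^ (β - 1)

/-- The mass weight `|x_S|⁻¹ g`. -/
def singWeight (S : Finset (Fin n)) (g : E n → ℝ) (x : E n) : ℝ := (√(sqOn S x))⁻¹ * g x

theorem exists_setIntegral_ball_le (b R : ℝ) : ∃ C : ℝ, 0 < C ∧ ∀ u : E n → ℝ, Continuous u →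
    HasCompactSupport u → (∀ x, 0 ≤ u x) →
    ∫ x in Metric.ball 0 R, u x ≤ C * ∫ x, u x * japSq x ^ b := by
  obtain ⟨C, hC⟩ := (isCompact_closedBall (0 : E n) R).exists_bound_of_continuousOn
    (continuous_japSq_rpow (n := n) (-b)).continuousOn
  refine ⟨max C 1, by positivity, fun u hu hs h0 => ?_⟩
  have hi : Integrable fun x => u x * japSq x ^ b :=
    (hu.mul (continuous_japSq_rpow b)).integrable_of_hasCompactSupport hs.mul_right
  have hp : ∀ x : E n, 0 < japSq x ^ b := fun x => Real.rpow_pos_of_pos (japSq_pos x) _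
  have hnn : ∀ x, 0 ≤ max C 1 * (u x * japSq x ^ b) := fun x =>
    mul_nonneg (by positivity) (mul_nonneg (h0 x) (hp x).le)
  rw [← integral_const_mul]
  refine le_trans ?_ (setIntegral_le_integral (s := Metric.ball 0 R) (hi.const_mul _)
    (Filter.Eventually.of_forall hnn))
  refine setIntegral_mono_on (hu.integrable_of_hasCompactSupport hs).integrableOn
    (hi.const_mul _).integrableOn Metric.isOpen_ball.measurableSet fun x hx => ?_
  have h1 := (le_abs_self _).trans (hC x (Metric.ball_subset_closedBall hx))
  have h2 : 1 ≤ max C 1 * japSq x ^ b := by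
    rw [Real.rpow_neg (japSq_pos x).le] at h1
    have := mul_le_mul_of_nonneg_right (h1.trans (le_max_left C 1)) (hp x).le
    rwa [inv_mul_cancel₀ (hp x).ne'] at this
  nlinarith [h0 x]

theorem IsTest.sq_setIntegral_le {φ : E n → ℝ} (hφ : IsTest φ) {K : Set (E n)}
    (hfin : volume K ≠ ⊤) : (volume.real K)⁻¹ * (∫ x in K, φ x) ^ 2 ≤ ∫ x in K, φ x ^ 2 := by
  have : IsFiniteMeasure (volume.restrict K) := ⟨by simpa using hfin.lt_top⟩
  have hJ : 0 ≤ ∫ x in K, φ x ^ 2 := integral_nonneg fun x => sq_nonneg _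
  rcases (measureReal_nonneg (μ := (volume : Measure (E n))) (s := K)).eq_or_lt with h0 | hV
  · simpa [← h0] using hJ
  have hi1 : Integrable φ (volume.restrict K) :=
    (hφ.1.continuous.integrable_of_hasCompactSupport hφ.2).restrict
  have hi2 : Integrable (fun x => φ x ^ 2) (volume.restrict K) :=
    ((hφ.1.continuous.pow 2).integrable_of_hasCompactSupport hφ.hasCompactSupport_sq).restrict
  set V := volume.real K
  set I := ∫ x in K, φ x
  set J := ∫ x in K, φ x ^ 2
  have h1 : 0 ≤ ∫ x in K, (φ x - V⁻¹ * I) ^ 2 := integral_nonneg fun x => sq_nonneg _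
  have h2 : ∫ x in K, (φ x - V⁻¹ * I) ^ 2 = J - V⁻¹ * I ^ 2 := by
    have : ∀ x, (φ x - V⁻¹ * I) ^ 2 = φ x ^ 2 - 2 * (V⁻¹ * I) * φ x + (V⁻¹ * I) ^ 2 :=
      fun x => by ring
    simp only [this]
    have h12 : Integrable (fun x => φ x ^ 2 - 2 * (V⁻¹ * I) * φ x) (volume.restrict K) :=
      hi2.sub (hi1.const_mul _)
    rw [integral_add h12 (integrable_const _), integral_sub hi2 (hi1.const_mul _),
      integral_const_mul]
    simp only [integral_const, measureReal_restrict_apply_univ, smul_eq_mul]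
    change J - 2 * (V⁻¹ * I) * I + V * (V⁻¹ * I) ^ 2 = _
    field_simp
    ring
  linarith

namespace AdmissibleWeights

variable {S : Finset (Fin n)} {β : ℝ} {w g : E n → ℝ}

theorem dim_pos (A : AdmissibleWeights S β w g) : 0 < n := by
  have h1 := A.two_le_card
  have h2 := S.card_le_univ
  simp only [Fintype.card_fin] at h2
  omega

theorem isLocallyFinite (A : AdmissibleWeights S β w g) : IsLocallyFiniteMeasure (weighted w) :=
  IsLocallyFiniteMeasure.withDensity_ofReal A.continuous_left

theorem memLp_gradient (A : AdmissibleWeights S β w g) {φ : E n → ℝ} (hφ : IsTest φ) :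
    MemLp (gradient φ) 2 (weighted w) := by
  have := A.isLocallyFinite
  exact hφ.continuous_gradient.memLp_of_hasCompactSupport hφ.hasCompactSupport_gradient

theorem measurable_singWeight (A : AdmissibleWeights S β w g) : Measurable (singWeight S g) :=
  (Real.continuous_sqrt.comp (contDiff_sqOn (m := 0) S).continuous).measurable.inv.mul
    A.continuous_right.measurable

theorem singWeight_nonneg (A : AdmissibleWeights S β w g) (x : E n) : 0 ≤ singWeight S g x :=
  mul_nonneg (inv_nonneg.2 (Real.sqrt_nonneg _)) (A.right_pos x).le

theorem exists_lintegral_sq_le (A : AdmissibleWeights S β w g) {ε : ℝ} (hε : 0 < ε) :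
    ∃ C R : ℝ, 0 < C ∧ ∀ φ : E n → ℝ, IsTest φ →
      ∫⁻ x, ENNReal.ofReal (‖φ x‖ ^ 2) ∂(weighted (singWeight S g)) ≤
        ENNReal.ofReal (ε * (∫ x, ‖gradient φ x‖ ^ 2 * japSq x ^ β) +
          C * ∫ x in Metric.ball 0 R, φ x ^ 2) := by
  obtain ⟨C₀, hC₀, hg⟩ := A.right_le
  obtain ⟨C, R, hC, h⟩ := exists_lintegral_mass_le A.dim_pos A.dim_add_pos A.two_le_card
    (ε := ε / C₀) (by positivity)
  refine ⟨C₀ * C, R, by positivity, fun φ hφ => ?_⟩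
  have hm : Measurable fun x => ENNReal.ofReal (‖φ x‖ ^ 2) :=
    (hφ.1.continuous.norm.pow 2).measurable.ennreal_ofReal
  rw [lintegral_weighted A.measurable_singWeight hm]
  calc _ ≤ ∫⁻ x, ENNReal.ofReal C₀ *
        ENNReal.ofReal (φ x ^ 2 * (japSq x ^ (β - 1) * (√(sqOn S x))⁻¹)) := by
        refine lintegral_mono fun x => ?_
        rw [← ENNReal.ofReal_mul (A.singWeight_nonneg x), ← ENNReal.ofReal_mul hC₀.le,
          Real.norm_eq_abs, sq_abs]
        refine ENNReal.ofReal_le_ofReal ?_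
        have h1 : 0 ≤ (√(sqOn S x))⁻¹ * φ x ^ 2 := by positivity
        have := mul_le_mul_of_nonneg_left (hg x) h1
        unfold singWeight
        linarith
    _ ≤ ENNReal.ofReal C₀ * ENNReal.ofReal (ε / C₀ * (∫ x, ‖gradient φ x‖ ^ 2 * japSq x ^ β) +
          C * ∫ x in Metric.ball 0 R, φ x ^ 2) := by
        rw [lintegral_const_mul' _ _ ENNReal.ofReal_ne_top]
        exact mul_le_mul_right (h φ hφ) _
    _ = _ := by
        rw [← ENNReal.ofReal_mul hC₀.le]
        congr 1
        field_simp

theorem memLp (A : AdmissibleWeights S β w g) {φ : E n → ℝ} (hφ : IsTest φ) :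
    MemLp φ 2 (weighted (singWeight S g)) := by
  obtain ⟨C, R, -, h⟩ := A.exists_lintegral_sq_le one_pos
  refine ⟨hφ.1.continuous.aestronglyMeasurable, ?_⟩
  have h1 := eLpNorm_nnreal_pow_eq_lintegral (μ := weighted (singWeight S g)) (f := φ) (p := 2)
    two_ne_zero
  have h2 : ((2 : NNReal) : ℝ) = (2 : ℕ) := by norm_num
  simp only [h2, ENNReal.rpow_natCast] at h1
  have h3 : ∀ x, ‖φ x‖ₑ ^ 2 = ENNReal.ofReal (‖φ x‖ ^ 2) := fun x => by
    rw [ENNReal.ofReal_pow (norm_nonneg _), ofReal_norm]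
  simp only [h3] at h1
  have h4 := h1.trans_lt ((h φ hφ).trans_lt ENNReal.ofReal_lt_top)
  exact (ENNReal.pow_lt_top_iff.1 h4).resolve_right two_ne_zero

/-- The inclusion of the test functions into the weighted `L²` space. -/
def inclusion (A : AdmissibleWeights S β w g) :
    TestSpace (weighted w) →ₗ[ℝ] Lp ℝ 2 (weighted (singWeight S g)) where
  toFun φ := (A.memLp φ.isTest).toLp _
  map_add' _ _ := MemLp.toLp_add _ _
  map_smul' _ _ := MemLp.toLp_const_smul _ _

theorem exists_dirichlet_le (A : AdmissibleWeights S β w g) : ∃ c : ℝ, 0 < c ∧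
    ∀ φ : TestSpace (weighted w),
      c * (∫ x, ‖gradient φ.toFun x‖ ^ 2 * japSq x ^ β) ≤ ‖φ‖ ^ 2 := by
  obtain ⟨c, hc, hw⟩ := A.le_left
  refine ⟨c, hc, fun φ => ?_⟩
  have hφ := φ.isTest
  have hn : ‖φ‖ = ‖φ.memLp.toLp _‖ := rfl
  have hm : Measurable fun x => ENNReal.ofReal (‖gradient φ.toFun x‖ ^ 2) :=
    (hφ.continuous_gradient.norm.pow 2).measurable.ennreal_ofReal
  have hwi := hφ.integrable_norm_gradient_sq_mul A.continuous_left
  have h0 : ∀ x, 0 ≤ ‖gradient φ.toFun x‖ ^ 2 * w x := fun x =>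
    mul_nonneg (sq_nonneg _) (A.left_pos x).le
  have h1 : ‖φ‖ ^ 2 = ∫ x, ‖gradient φ.toFun x‖ ^ 2 * w x := by
    rw [← ENNReal.ofReal_eq_ofReal_iff (sq_nonneg _) (integral_nonneg h0), hn,
      ofReal_norm_toLp_sq, lintegral_weighted A.continuous_left.measurable hm,
      ofReal_integral_eq_lintegral_ofReal hwi (Filter.Eventually.of_forall h0)]
    refine lintegral_congr fun x => ?_
    rw [← ENNReal.ofReal_mul (A.left_pos x).le, mul_comm]
  rw [h1, ← integral_const_mul]
  refine integral_mono ((hφ.integrable_norm_gradient_sq_mul (continuous_japSq_rpow β)).const_mul _)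
    hwi fun x => ?_
  have := mul_le_mul_of_nonneg_left (hw x) (sq_nonneg ‖gradient φ.toFun x‖)
  simp only
  linarith

/-- Finitely many averages, as a bounded operator on the space of test functions. -/
theorem exists_average_map (A : AdmissibleWeights S β w g) (R : ℝ) {N : ℕ} (K : Fin N → Set (E n))
    (hK : ∀ i, K i ⊆ Metric.ball 0 R) {b : ℝ} (hb : 0 ≤ b) :
    ∃ F : TestSpace (weighted w) →L[ℝ] EuclideanSpace ℝ (Fin N), ∀ φ : TestSpace (weighted w),
      ‖F φ‖ ^ 2 = b * ∑ i, (volume.real (K i))⁻¹ * (∫ x in K i, φ.toFun x) ^ 2 := by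
  obtain ⟨c, hc, hdir⟩ := A.exists_dirichlet_le
  obtain ⟨C₁, hC₁, hhardy⟩ := exists_hardy A.dim_pos A.dim_add_pos
  obtain ⟨C₂, hC₂, hball⟩ := exists_setIntegral_ball_le (n := n) (β - 1) R
  have hint : ∀ φ : TestSpace (weighted w), Integrable φ.toFun := fun φ =>
    φ.isTest.1.continuous.integrable_of_hasCompactSupport φ.isTest.2
  let F₀ : TestSpace (weighted w) →ₗ[ℝ] EuclideanSpace ℝ (Fin N) :=
    { toFun := fun φ => WithLp.toLp 2 fun i =>
        √(b * (volume.real (K i))⁻¹) * ∫ x in K i, φ.toFun x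
      map_add' := fun φ ψ => by
        ext i
        have : ∫ x in K i, (φ + ψ).toFun x = (∫ x in K i, φ.toFun x) + ∫ x in K i, ψ.toFun x :=
          integral_add (hint φ).restrict (hint ψ).restrict
        simp [this, mul_add]
      map_smul' := fun a φ => by
        ext i
        have : ∫ x in K i, (a • φ).toFun x = a * ∫ x in K i, φ.toFun x :=
          integral_const_mul _ _
        simp [this]
        ring }
  have hF₀ : ∀ φ, ‖F₀ φ‖ ^ 2 = b * ∑ i, (volume.real (K i))⁻¹ * (∫ x in K i, φ.toFun x) ^ 2 := by
    intro φ
    rw [EuclideanSpace.norm_sq_eq, Finset.mul_sum]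
    refine Finset.sum_congr rfl fun i _ => ?_
    have h0 : 0 ≤ b * (volume.real (K i))⁻¹ := mul_nonneg hb (inv_nonneg.2 measureReal_nonneg)
    simp only [F₀, LinearMap.coe_mk, AddHom.coe_mk, Real.norm_eq_abs, sq_abs, mul_pow,
      Real.sq_sqrt h0]
    ring
  have hbound : ∀ φ, ‖F₀ φ‖ ≤ √(b * (N * (C₂ * (C₁ * c⁻¹)))) * ‖φ‖ := by
    intro φ
    have hφ := φ.isTest
    have h1 : ∀ i, (volume.real (K i))⁻¹ * (∫ x in K i, φ.toFun x) ^ 2 ≤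
        C₂ * (C₁ * c⁻¹) * ‖φ‖ ^ 2 := by
      intro i
      have hi2 : Integrable fun x => φ.toFun x ^ 2 :=
        (hφ.1.continuous.pow 2).integrable_of_hasCompactSupport hφ.hasCompactSupport_sq
      calc _ ≤ ∫ x in K i, φ.toFun x ^ 2 :=
            hφ.sq_setIntegral_le ((measure_mono (hK i)).trans_lt measure_ball_lt_top).ne
        _ ≤ ∫ x in Metric.ball 0 R, φ.toFun x ^ 2 :=
            setIntegral_mono_set hi2.integrableOn
              (Filter.Eventually.of_forall fun x => sq_nonneg _) (hK i).eventuallyLE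
        _ ≤ C₂ * ∫ x, φ.toFun x ^ 2 * japSq x ^ (β - 1) :=
            hball _ (hφ.1.continuous.pow 2) hφ.hasCompactSupport_sq fun x => sq_nonneg _
        _ ≤ C₂ * (C₁ * ∫ x, ‖gradient φ.toFun x‖ ^ 2 * japSq x ^ β) :=
            mul_le_mul_of_nonneg_left (hhardy _ hφ) hC₂.le
        _ ≤ C₂ * (C₁ * (c⁻¹ * ‖φ‖ ^ 2)) := by
            gcongr
            rw [inv_mul_eq_div, le_div_iff₀' hc]
            exact hdir φ
        _ = _ := by ring
    refine le_of_sq_le_sq ?_ (by positivity)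
    rw [hF₀, mul_pow, Real.sq_sqrt (by positivity), mul_assoc]
    refine mul_le_mul_of_nonneg_left ((Finset.sum_le_sum fun i _ => h1 i).trans_eq ?_) hb
    simp
    ring
  exact ⟨F₀.mkContinuous _ hbound, hF₀⟩

/-- Up to a small multiple of the Dirichlet norm, the weighted `L²` norm is controlled by finitely
many averages. -/
theorem exists_norm_inclusion_le (A : AdmissibleWeights S β w g) {ε : ℝ} (hε : 0 < ε) :
    ∃ (N : ℕ) (F : TestSpace (weighted w) →L[ℝ] EuclideanSpace ℝ (Fin N)),
      ∀ φ, ‖A.inclusion φ‖ ≤ ε * ‖φ‖ + ‖F φ‖ := by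
  obtain ⟨c, hc, hdir⟩ := A.exists_dirichlet_le
  obtain ⟨C₁, R, hC₁, hmass⟩ := A.exists_lintegral_sq_le (ε := ε ^ 2 * c / 2) (by positivity)
  obtain ⟨C₂, hC₂, hball⟩ := exists_setIntegral_ball_le (n := n) β R
  obtain ⟨N, K, hK, hrel⟩ := exists_setIntegral_ball_sq_le (n := n) R
    (ε := ε ^ 2 * c / 2 / (C₁ * C₂)) (by positivity)
  obtain ⟨F, hF⟩ := A.exists_average_map R K hK hC₁.le
  refine ⟨N, F, fun φ => ?_⟩
  have hφ := φ.isTest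
  set D := ∫ x, ‖gradient φ.toFun x‖ ^ 2 * japSq x ^ β
  set T := ∑ i, (volume.real (K i))⁻¹ * (∫ x in K i, φ.toFun x) ^ 2
  have hD : 0 ≤ D := integral_nonneg fun x =>
    mul_nonneg (sq_nonneg _) (Real.rpow_nonneg (japSq_pos x).le _)
  have hB : 0 ≤ ∫ x in Metric.ball 0 R, φ.toFun x ^ 2 := integral_nonneg fun x => sq_nonneg _
  have h1 : ‖A.inclusion φ‖ ^ 2 ≤ ε ^ 2 * c / 2 * D
      + C₁ * ∫ x in Metric.ball 0 R, φ.toFun x ^ 2 := by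
    refine (ENNReal.ofReal_le_ofReal_iff (by positivity)).1 ?_
    exact (ofReal_norm_toLp_sq (A.memLp hφ)).trans_le (hmass _ hφ)
  have h2 : ε ^ 2 * c / 2 / (C₁ * C₂) * ∫ x in Metric.ball 0 R, ‖gradient φ.toFun x‖ ^ 2 ≤
      ε ^ 2 * c / 2 / (C₁ * C₂) * (C₂ * D) :=
    mul_le_mul_of_nonneg_left (hball _ (hφ.continuous_gradient.norm.pow 2)
      hφ.hasCompactSupport_norm_gradient_sq fun x => sq_nonneg _) (by positivity)
  have h3 : C₁ * ∫ x in Metric.ball 0 R, φ.toFun x ^ 2 ≤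
      C₁ * (ε ^ 2 * c / 2 / (C₁ * C₂) * (C₂ * D) + T) :=
    mul_le_mul_of_nonneg_left ((hrel _ hφ).trans (by linarith)) hC₁.le
  have h4 : C₁ * (ε ^ 2 * c / 2 / (C₁ * C₂) * (C₂ * D) + T) = ε ^ 2 * c / 2 * D + ‖F φ‖ ^ 2 := by
    have : ‖F φ‖ ^ 2 = C₁ * T := hF φ
    rw [this]; field_simp
  have h5 : ε ^ 2 * (c * D) ≤ ε ^ 2 * ‖φ‖ ^ 2 :=
    mul_le_mul_of_nonneg_left (hdir φ) (sq_nonneg ε)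
  refine le_of_sq_le_sq ?_ (by positivity)
  have h6 : 0 ≤ ε * ‖φ‖ * ‖F φ‖ := by positivity
  nlinarith

end AdmissibleWeights

end Weights

/-! ### Injectivity -/

section Closable

variable {n : ℕ}

/-- The map `φ ↦ Dφ` as an isometry of the completion into the weighted `L²` space. -/
theorem exists_gradient_extension (μ : Measure (E n)) :
    ∃ G : D12 μ →L[ℝ] Lp (E n) 2 μ,
      (∀ φ : TestSpace μ, G (φ : D12 μ) = gradMap μ φ) ∧ ∀ ξ, ‖G ξ‖ = ‖ξ‖ := by
  have hnorm : ∀ φ : TestSpace μ, ‖gradMap μ φ‖ = ‖φ‖ := fun _ => rfl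
  let G₀ : TestSpace μ →L[ℝ] Lp (E n) 2 μ :=
    (gradMap μ).mkContinuous 1 fun φ => by rw [hnorm, one_mul]
  have hG : ∀ φ : TestSpace μ, G₀.extend UniformSpace.Completion.toComplL (φ : D12 μ)
      = gradMap μ φ := G₀.extend_eq UniformSpace.Completion.denseRange_coe
        (UniformSpace.Completion.isUniformInducing_coe _)
  refine ⟨G₀.extend UniformSpace.Completion.toComplL, hG, fun ξ => ?_⟩
  induction ξ using UniformSpace.Completion.induction_on with
  | hp => exact isClosed_eq (by fun_prop) (by fun_prop)
  | ih φ => rw [hG, UniformSpace.Completion.norm_coe, hnorm]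

theorem volume_sqOn_eq_zero {S : Finset (Fin n)} (hS : S.Nonempty) :
    volume {x : E n | sqOn S x = 0} = 0 := by
  obtain ⟨i, hi⟩ := hS
  have hne : (LinearMap.ker (EuclideanSpace.proj i : E n →L[ℝ] ℝ).toLinearMap) ≠ ⊤ := by
    intro h
    have : EuclideanSpace.single i (1 : ℝ) ∈
        LinearMap.ker (EuclideanSpace.proj i : E n →L[ℝ] ℝ).toLinearMap := h ▸ Submodule.mem_top
    simp at this
  refine measure_mono_null (fun x hx => ?_) (Measure.addHaar_submodule volume _ hne)
  have h0 := (Finset.sum_eq_zero_iff_of_nonneg fun i _ => sq_nonneg (x i)).1 hx i hi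
  simpa using h0

theorem ae_sqOn_pos {S : Finset (Fin n)} (hS : S.Nonempty) :
    ∀ᵐ x : E n, 0 < sqOn S x := by
  filter_upwards [measure_eq_zero_iff_ae_notMem.1 (volume_sqOn_eq_zero hS)] with x hx
  exact lt_of_le_of_ne (sqOn_nonneg S x) (Ne.symm hx)

namespace AdmissibleWeights

variable {S : Finset (Fin n)} {β : ℝ} {w g : E n → ℝ}

/-- The mass weight is locally integrable across `{x_S = 0}`, as every bump function has finite
mass. -/
theorem isFiniteOnCompacts (A : AdmissibleWeights S β w g) :
    IsFiniteMeasureOnCompacts (weighted (singWeight S g)) := by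
  refine ⟨fun K hK => ?_⟩
  obtain ⟨R, hR, hKR⟩ := hK.isBounded.subset_closedBall_lt 0 (0 : E n)
  let f : ContDiffBump (0 : E n) := ⟨R, R + 1, hR, by linarith⟩
  have hf : MemLp f 2 (weighted (singWeight S g)) := A.memLp ⟨f.contDiff, f.hasCompactSupport⟩
  have h1 := hf.integrable_sq.measure_norm_ge_lt_top one_pos
  refine (measure_mono fun x hx => ?_).trans_lt h1
  have : f x = 1 := f.one_of_mem_closedBall (hKR hx)
  simp [this]

/-- A member of the completion is determined by its image in the weighted `L²` space: its gradient
is the distributional gradient of that image, and a member without gradient vanishes. -/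
theorem injective (A : AdmissibleWeights S β w g)
    (J : D12 (weighted w) →L[ℝ] Lp ℝ 2 (weighted (singWeight S g)))
    (hJ : ∀ φ : TestSpace (weighted w), J (φ : D12 _) = A.inclusion φ) :
    Function.Injective J := by
  obtain ⟨G, hG, hGn⟩ := exists_gradient_extension (weighted w)
  have := A.isLocallyFinite
  have := A.isFiniteOnCompacts
  have hw0 : ∀ x, w x ≠ 0 := fun x => (A.left_pos x).ne'
  have hSne : S.Nonempty := Finset.card_pos.1 (by have := A.two_le_card; omega)
  rw [injective_iff_map_eq_zero]
  intro ξ hξ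
  have hcoord : ∀ i : Fin n, ∀ᵐ x ∂(weighted w), (w x)⁻¹ * (G ξ : E n → E n) x i = 0 := by
    intro i
    have hloc : LocallyIntegrable (fun x => (w x)⁻¹ * (G ξ : E n → E n) x i) (weighted w) := by
      have h1 : LocallyIntegrable (fun x => (G ξ : E n → E n) x i) (weighted w) :=
        (((EuclideanSpace.proj i : E n →L[ℝ] ℝ).comp_memLp' (Lp.memLp (G ξ)))).locallyIntegrable
          one_le_two
      rw [← locallyIntegrableOn_univ] at h1 ⊢
      exact h1.continuousOn_mul (A.continuous_left.inv₀ hw0).continuousOn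
        isClosed_univ.isLocallyClosed
    refine ae_eq_zero_of_integral_contDiff_smul_eq_zero hloc fun θ hθ hθs => ?_
    have hT : IsTest θ := ⟨hθ, hθs⟩
    have hac : Continuous fun x => (θ x * (w x)⁻¹) • (EuclideanSpace.single i (1 : ℝ) : E n) :=
      (hθ.continuous.mul (A.continuous_left.inv₀ hw0)).smul continuous_const
    have hbc : Continuous fun x => √(sqOn S x) * (g x)⁻¹ * gradient θ x i :=
      ((Real.continuous_sqrt.comp (contDiff_sqOn (m := 0) S).continuous).mul
        (A.continuous_right.inv₀ fun x => (A.right_pos x).ne')).mul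
        ((contDiff_coord (m := 0) i).continuous.comp hT.continuous_gradient)
    have has : HasCompactSupport fun x =>
        (θ x * (w x)⁻¹) • (EuclideanSpace.single i (1 : ℝ) : E n) :=
      (hθs.mul_right (f' := fun x => (w x)⁻¹)).smul_right
    have hgs : HasCompactSupport fun x => gradient θ x i :=
      hT.hasCompactSupport_gradient.comp_left (g := fun v : E n => v i) rfl
    have ha : MemLp (fun x => (θ x * (w x)⁻¹) • (EuclideanSpace.single i (1 : ℝ) : E n)) 2
      (weighted w) := hac.memLp_of_hasCompactSupport has
    have hb : MemLp (fun x => √(sqOn S x) * (g x)⁻¹ * gradient θ x i) 2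
      (weighted (singWeight S g)) := hbc.memLp_of_hasCompactSupport hgs.mul_left
    have hA : ∀ u : Lp (E n) 2 (weighted w), inner ℝ (ha.toLp _) u =
        ∫ x, θ x * (w x)⁻¹ * (u : E n → E n) x i ∂(weighted w) := by
      intro u
      rw [L2.inner_def]
      refine integral_congr_ae ?_
      filter_upwards [ha.coeFn_toLp] with x hx
      rw [hx, real_inner_smul_left, EuclideanSpace.inner_single_left]
      simp
    -- integration by parts, which passes to the completion by continuity
    have hid : ∀ ζ : D12 (weighted w), inner ℝ (ha.toLp _) (G ζ) = -inner ℝ (hb.toLp _) (J ζ) := by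
      intro ζ
      induction ζ using UniformSpace.Completion.induction_on with
      | hp => exact isClosed_eq (by fun_prop) (by fun_prop)
      | ih φ =>
        have hφ := φ.isTest
        have e1 : inner ℝ (ha.toLp _) (G φ) = ∫ x, θ x * gradient φ.toFun x i := by
          have h1 : (gradMap (weighted w) φ : E n → E n) =ᵐ[weighted w] gradient φ.toFun :=
            φ.memLp.coeFn_toLp
          rw [hA, hG, ← integral_congr_ae (f := fun x => θ x * (w x)⁻¹ * gradient φ.toFun x i)
              (by filter_upwards [h1] with x hx; rw [hx]),
            integral_weighted A.continuous_left.measurable fun x => (A.left_pos x).le]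
          congr 1; ext x
          have := hw0 x
          field_simp
        have e2 : inner ℝ (hb.toLp _) (J φ) = ∫ x, gradient θ x i * φ.toFun x := by
          have h1 : (A.inclusion φ : E n → ℝ) =ᵐ[weighted (singWeight S g)] φ.toFun :=
            (A.memLp hφ).coeFn_toLp
          rw [hJ, L2.inner_def, ← integral_congr_ae
            (f := fun x => √(sqOn S x) * (g x)⁻¹ * gradient θ x i * φ.toFun x)
              (by filter_upwards [h1, hb.coeFn_toLp] with x hx hx'; rw [hx, hx']; simp [mul_comm]),
            integral_weighted A.measurable_singWeight A.singWeight_nonneg]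
          refine integral_congr_ae ?_
          filter_upwards [ae_sqOn_pos hSne] with x hx
          have h2 := (Real.sqrt_pos.2 hx).ne'
          have h3 := (A.right_pos x).ne'
          simp only [singWeight]
          field_simp
        rw [e1, e2]
        have hc1 : Continuous fun x => gradient φ.toFun x i :=
          (contDiff_coord (m := 0) i).continuous.comp hφ.continuous_gradient
        have hc2 : Continuous fun x => gradient θ x i :=
          (contDiff_coord (m := 0) i).continuous.comp hT.continuous_gradient
        simp only [← fderiv_single] at hc1 hc2 hgs ⊢
        exact integral_mul_fderiv_eq_neg_fderiv_mul_of_integrable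
          ((hc2.mul hφ.1.continuous).integrable_of_hasCompactSupport hgs.mul_right)
          ((hθ.continuous.mul hc1).integrable_of_hasCompactSupport hθs.mul_right)
          ((hθ.continuous.mul hφ.1.continuous).integrable_of_hasCompactSupport hθs.mul_right)
          (fun x _ => hT.differentiable x) (fun x _ => hφ.differentiable x)
    have h0 := hid ξ
    rw [hξ, inner_zero_right, neg_zero, hA] at h0
    simpa only [smul_eq_mul, mul_assoc] using h0
  have hG0 : G ξ = 0 := by
    refine (Lp.eq_zero_iff_ae_eq_zero).2 ?_
    filter_upwards [ae_all_iff.2 hcoord] with x hx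
    ext i
    simpa [hw0 x] using hx i
  rw [← norm_eq_zero, ← hGn, hG0, norm_zero]

/-- The compact embedding for admissible weights. -/
theorem exists_compact_injective (A : AdmissibleWeights S β w g) :
    ∃ J : D12 (weighted w) →L[ℝ] Lp ℝ 2 (weighted (singWeight S g)),
      (∀ φ : TestSpace (weighted w), J (φ : D12 _) =ᵐ[weighted (singWeight S g)] φ.toFun) ∧
      Function.Injective J ∧ IsCompactOperator J := by
  obtain ⟨J, hJ, hc⟩ := exists_compact_extension A.inclusion fun _ hε =>
    A.exists_norm_inclusion_le hε
  refine ⟨J, fun φ => ?_, A.injective J hJ, hc⟩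
  rw [hJ]
  exact (A.memLp φ.isTest).coeFn_toLp

end AdmissibleWeights

end Closable

/-! ### The weights of the extremal function -/

section Extremal

variable {n : ℕ}

/-- The indices of the coordinates that make up `y`. -/
def yIndices (n k : ℕ) : Finset (Fin n) := Finset.univ.filter fun i : Fin n => i.val < k

theorem card_yIndices {k : ℕ} (hkn : k ≤ n) : (yIndices n k).card = k := by
  rw [yIndices, Fin.card_filter_val_lt, min_eq_right hkn]

theorem normY_eq (k : ℕ) (x : E n) : normY n k x = √(sqOn (yIndices n k) x) := rfl

theorem normY_nonneg (k : ℕ) (x : E n) : 0 ≤ normY n k x := Real.sqrt_nonneg _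

theorem normY_sq (k : ℕ) (x : E n) : normY n k x ^ 2 = sqOn (yIndices n k) x :=
  Real.sq_sqrt (sqOn_nonneg _ _)

theorem normZ_sq (k : ℕ) (x : E n) : normZ n k x ^ 2 = ‖x‖ ^ 2 - sqOn (yIndices n k) x := by
  rw [normZ, Real.sq_sqrt (Finset.sum_nonneg fun i _ => sq_nonneg _), ← sqOn_univ, sqOn, sqOn,
    yIndices, ← Finset.sum_filter_add_sum_filter_not Finset.univ (fun i : Fin n => i.val < k)]
  simp only [not_lt]
  ring

/-- The base `(1 + |y|)² + |z|²` of the extremal function, expanded as `1 + 2|y| + |x|²`. -/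
def extBase (n k : ℕ) (x : E n) : ℝ := japSq x + 2 * normY n k x

theorem extremal_eq (k : ℕ) (p a : ℝ) (x : E n) :
    extremal n k p a x = a * extBase n k x ^ (-((n : ℝ) - p) / (2 * (p - 1))) := by
  rw [extremal, extBase, normZ_sq, ← normY_sq, japSq]
  congr 2
  ring

theorem japSq_le_extBase (k : ℕ) (x : E n) : japSq x ≤ extBase n k x := by
  have := normY_nonneg k x
  unfold extBase; linarith

theorem extBase_le (k : ℕ) (x : E n) : extBase n k x ≤ 2 * japSq x := by
  have h1 : normY n k x ^ 2 ≤ ‖x‖ ^ 2 := normY_sq k x ▸ sqOn_le_norm_sq _ x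
  unfold extBase japSq
  nlinarith [sq_nonneg (normY n k x - 1)]

theorem extBase_pos (k : ℕ) (x : E n) : 0 < extBase n k x :=
  (japSq_pos x).trans_le (japSq_le_extBase k x)

theorem continuous_extBase (k : ℕ) : Continuous (extBase n k) :=
  (contDiff_japSq (m := 0)).continuous.add (continuous_const.mul
    (Real.continuous_sqrt.comp (contDiff_sqOn (m := 0) _).continuous))

theorem extBase_rpow_le (k : ℕ) (b : ℝ) : ∃ C : ℝ, 0 < C ∧ ∀ x : E n,
    extBase n k x ^ b ≤ C * japSq x ^ b ∧ japSq x ^ b ≤ C * extBase n k x ^ b := by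
  have key : ∀ b : ℝ, ∃ C : ℝ, 1 ≤ C ∧ ∀ x : E n, extBase n k x ^ b ≤ C * japSq x ^ b := by
    intro b
    rcases le_total 0 b with hb | hb
    · refine ⟨2 ^ b, Real.one_le_rpow one_le_two hb, fun x => ?_⟩
      rw [← Real.mul_rpow zero_le_two (japSq_pos x).le]
      exact Real.rpow_le_rpow (extBase_pos k x).le (extBase_le k x) hb
    · refine ⟨1, le_rfl, fun x => ?_⟩
      rw [one_mul]
      exact Real.rpow_le_rpow_of_nonpos (japSq_pos x) (japSq_le_extBase k x) hb
  obtain ⟨C₁, h₁, H₁⟩ := key b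
  obtain ⟨C₂, h₂, H₂⟩ := key (-b)
  refine ⟨max C₁ C₂, by positivity, fun x => ⟨(H₁ x).trans ?_, ?_⟩⟩
  · exact mul_le_mul_of_nonneg_right (le_max_left _ _) (Real.rpow_nonneg (japSq_pos x).le _)
  · have hx := H₂ x
    have hA := Real.rpow_pos_of_pos (extBase_pos k x) b
    have hq := Real.rpow_pos_of_pos (japSq_pos x) b
    rw [Real.rpow_neg (extBase_pos k x).le, Real.rpow_neg (japSq_pos x).le, ← div_eq_mul_inv,
      le_div_iff₀ hq, inv_mul_le_iff₀ hA] at hx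
    exact hx.trans (by rw [mul_comm]; exact mul_le_mul_of_nonneg_right (le_max_right _ _) hA.le)

theorem hasGradientAt_extBase {k : ℕ} {x : E n} (hx : 0 < sqOn (yIndices n k) x) :
    ∃ v : E n, HasGradientAt (extBase n k) v x ∧ ‖v‖ ^ 2 = 4 * extBase n k x := by
  set S := yIndices n k
  set s := √(sqOn S x) with hs
  have hs0 : 0 < s := Real.sqrt_pos.2 hx
  have hs2 : s ^ 2 = sqOn S x := Real.sq_sqrt hx.le
  -- the gradient is `2 x + 2 y / |y|`
  let v : E n := WithLp.toLp 2 fun i => 2 * x i + if i ∈ S then 2 * x i / s else 0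
  refine ⟨v, ?_, ?_⟩
  · have h1 := (hasFDerivAt_japSq x).add
      (((hasFDerivAt_sqOn S x).sqrt hx.ne').const_mul 2)
    rw [hasGradientAt_iff_hasFDerivAt]
    refine HasFDerivAt.congr_fderiv (f := extBase n k) h1 ?_
    ext u
    have hinner : inner ℝ v u = 2 * inner ℝ x u + 2 / s * ∑ i ∈ S, x i * u i := by
      simp only [v, PiLp.inner_apply, RCLike.inner_apply, conj_trivial, mul_add, mul_ite, mul_zero,
        Finset.sum_add_distrib, Finset.sum_ite_mem, Finset.univ_inter, Finset.mul_sum]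
      congr 1 <;> refine Finset.sum_congr rfl fun i _ => by ring
    rw [InnerProductSpace.toDual_apply_apply, hinner]
    simp [← hs, Finset.mul_sum]
    refine Finset.sum_congr rfl fun i _ => by ring
  · rw [← sqOn_univ, sqOn]
    have : ∀ i, v i ^ 2 = 4 * x i ^ 2 + if i ∈ S then (8 / s + 4 / s ^ 2) * x i ^ 2 else 0 := by
      intro i
      simp only [v]
      split_ifs
      · field_simp; ring
      · ring
    simp only [this]
    rw [Finset.sum_add_distrib, ← Finset.mul_sum, Finset.sum_ite_mem, Finset.univ_inter,
      ← Finset.mul_sum]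
    change 4 * sqOn Finset.univ x + _ * sqOn S x = 4 * (1 + ‖x‖ ^ 2 + 2 * s)
    rw [sqOn_univ, ← hs2]
    field_simp
    ring

theorem norm_gradient_extremal {k : ℕ} {p a : ℝ} (ha : 0 < a) (hp : 1 < p) (hpn : p < n) {x : E n}
    (hx : 0 < sqOn (yIndices n k) x) :
    ‖gradient (extremal n k p a) x‖ = a * (((n : ℝ) - p) / (p - 1)) *
      extBase n k x ^ (-((n : ℝ) - 1) / (2 * (p - 1))) := by
  obtain ⟨v, hv, hvn⟩ := hasGradientAt_extBase hx
  have hA := extBase_pos k x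
  have hp1 : 0 < p - 1 := by linarith
  have hnp : 0 < (n : ℝ) - p := by linarith
  set e := -((n : ℝ) - p) / (2 * (p - 1)) with he
  have hE : extremal n k p a = fun x => a * extBase n k x ^ e := funext (extremal_eq k p a)
  have h1 := (hv.hasFDerivAt.rpow_const (p := e) (Or.inl hA.ne')).const_mul a
  rw [← hE] at h1
  rw [norm_gradient, h1.fderiv, norm_smul, norm_smul, LinearIsometryEquiv.norm_map,
    Real.norm_eq_abs, Real.norm_eq_abs, abs_of_pos ha, abs_mul,
    abs_of_pos (Real.rpow_pos_of_pos hA _)]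
  have hvn' : ‖v‖ = 2 * extBase n k x ^ (1 / 2 : ℝ) := by
    rw [← Real.sqrt_eq_rpow, ← Real.sqrt_sq (norm_nonneg v), hvn,
      Real.sqrt_mul (by norm_num), show (4 : ℝ) = 2 ^ 2 by norm_num, Real.sqrt_sq zero_le_two]
  have he' : |e| = ((n : ℝ) - p) / (2 * (p - 1)) := by
    rw [he, neg_div, abs_neg, abs_of_pos (by positivity)]
  have hexp : extBase n k x ^ (-((n : ℝ) - 1) / (2 * (p - 1)))
      = extBase n k x ^ (e - 1) * extBase n k x ^ (1 / 2 : ℝ) := by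
    rw [← Real.rpow_add hA]
    congr 1
    rw [he]; field_simp; ring
  rw [hvn', he', hexp]
  field_simp

/-- The exponent `β` for which `|Dv|^(p-2)` is comparable to `⟨x⟩^{2β}`. -/
def weightExp (n : ℕ) (p : ℝ) : ℝ := -((n : ℝ) - 1) / (2 * (p - 1)) * (p - 2)

theorem dim_add_weightExp {p : ℝ} (hp : 1 < p) :
    (n : ℝ) + 2 * weightExp n p - 2 = ((n : ℝ) - p) / (p - 1) := by
  have hp1 : p - 1 ≠ 0 := by linarith
  unfold weightExp; field_simp; ring

theorem weightExp_sub_one {p : ℝ} (hp : 1 < p) (hpn : p < n) :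
    -((n : ℝ) - p) / (2 * (p - 1)) * (critExp n p - 2) = weightExp n p - 1 := by
  have hp1 : p - 1 ≠ 0 := by linarith
  have hnp : (n : ℝ) - p ≠ 0 := by linarith
  unfold weightExp critExp; field_simp; ring

theorem gradWeight_ae_eq {k : ℕ} (hk : (yIndices n k).Nonempty) {p a : ℝ} (ha : 0 < a) (hp : 1 < p)
    (hpn : p < n) : gradWeight n k p a =ᵐ[volume] fun x =>
      (a * (((n : ℝ) - p) / (p - 1))) ^ (p - 2) * extBase n k x ^ weightExp n p := by
  filter_upwards [ae_sqOn_pos hk] with x hx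
  have hA := extBase_pos k x
  have hc : 0 ≤ a * (((n : ℝ) - p) / (p - 1)) :=
    mul_nonneg ha.le (div_nonneg (by linarith) (by linarith))
  rw [gradWeight, norm_gradient_extremal ha hp hpn hx,
    Real.mul_rpow hc (Real.rpow_nonneg hA.le _), ← Real.rpow_mul hA.le, weightExp]

theorem massWeight_eq {k : ℕ} {p a : ℝ} (ha : 0 < a) (hp : 1 < p) (hpn : p < n) :
    massWeight n k p a = singWeight (yIndices n k) fun x =>
      a ^ (critExp n p - 2) * extBase n k x ^ (weightExp n p - 1) := by
  funext x
  have hA := extBase_pos k x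
  rw [massWeight, singWeight, extremal_eq, Real.mul_rpow ha.le (Real.rpow_nonneg hA.le _),
    ← Real.rpow_mul hA.le, weightExp_sub_one hp hpn, normY_eq]

theorem admissibleWeights_extremal {k : ℕ} (hk : 2 ≤ k) (hkn : k ≤ n) {p a : ℝ} (ha : 0 < a)
    (hp : 1 < p) (hpn : p < n) :
    AdmissibleWeights (yIndices n k) (weightExp n p)
      (fun x => (a * (((n : ℝ) - p) / (p - 1))) ^ (p - 2) * extBase n k x ^ weightExp n p)
      (fun x => a ^ (critExp n p - 2) * extBase n k x ^ (weightExp n p - 1)) := by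
  have hnp : 0 < ((n : ℝ) - p) / (p - 1) := div_pos (by linarith) (by linarith)
  have hcont : ∀ b : ℝ, Continuous fun x : E n => extBase n k x ^ b := fun b =>
    (continuous_extBase k).rpow_const fun x => Or.inl (extBase_pos k x).ne'
  have hpos : ∀ (b : ℝ) (x : E n), 0 < extBase n k x ^ b := fun b x =>
    Real.rpow_pos_of_pos (extBase_pos k x) b
  have hc1 : 0 < (a * (((n : ℝ) - p) / (p - 1))) ^ (p - 2) := Real.rpow_pos_of_pos (by positivity) _
  have hc2 : 0 < a ^ (critExp n p - 2) := Real.rpow_pos_of_pos ha _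
  refine ⟨by rwa [card_yIndices hkn], by rwa [dim_add_weightExp hp],
    continuous_const.mul (hcont _), fun x => mul_pos hc1 (hpos _ x), ?_,
    continuous_const.mul (hcont _), fun x => mul_pos hc2 (hpos _ x), ?_⟩
  · obtain ⟨C, hC, h⟩ := extBase_rpow_le (n := n) k (weightExp n p)
    refine ⟨(a * (((n : ℝ) - p) / (p - 1))) ^ (p - 2) * C⁻¹, by positivity, fun x => ?_⟩
    rw [mul_assoc]
    refine mul_le_mul_of_nonneg_left ?_ hc1.le
    rw [inv_mul_le_iff₀ hC]
    exact (h x).2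
  · obtain ⟨C, hC, h⟩ := extBase_rpow_le (n := n) k (weightExp n p - 1)
    refine ⟨a ^ (critExp n p - 2) * C, by positivity, fun x => ?_⟩
    rw [mul_assoc]
    exact mul_le_mul_of_nonneg_left (h x).1 hc2.le

end Extremal

end HardySobolevMazya

end

theorem proposition2p1 (n k : ℕ) (hn : 4 ≤ n) (hk : 3 ≤ k) (hkn : k ≤ n)
    (p : ℝ) (hp : 1 < p) (hpn : p < n) (a : ℝ) (ha : 0 < a) :
    (∀ φ : HardySobolevMazya.E n → ℝ, HardySobolevMazya.IsTest φ →
      MeasureTheory.MemLp (gradient φ) 2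
          (HardySobolevMazya.weighted (HardySobolevMazya.gradWeight n k p a)) ∧
        MeasureTheory.MemLp φ 2
          (HardySobolevMazya.weighted (HardySobolevMazya.massWeight n k p a))) ∧
    ∃ J : HardySobolevMazya.D12
          (HardySobolevMazya.weighted (HardySobolevMazya.gradWeight n k p a)) →L[ℝ]
        MeasureTheory.Lp ℝ 2
          (HardySobolevMazya.weighted (HardySobolevMazya.massWeight n k p a)),
      (∀ φ : HardySobolevMazya.TestSpace
            (HardySobolevMazya.weighted (HardySobolevMazya.gradWeight n k p a)),
        J (φ : HardySobolevMazya.D12 _) =ᵐ[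
          HardySobolevMazya.weighted (HardySobolevMazya.massWeight n k p a)] φ.toFun) ∧
      Function.Injective J ∧
      IsCompactOperator J := by
  have hk2 : 2 ≤ k := by omega
  have hy : (HardySobolevMazya.yIndices n k).Nonempty :=
    Finset.card_pos.1 (by rw [HardySobolevMazya.card_yIndices hkn]; omega)
  have A := HardySobolevMazya.admissibleWeights_extremal hk2 hkn ha hp hpn
  have hw : HardySobolevMazya.weighted (HardySobolevMazya.gradWeight n k p a) =
      HardySobolevMazya.weighted fun x => (a * (((n : ℝ) - p) / (p - 1))) ^ (p - 2) *
        HardySobolevMazya.extBase n k x ^ HardySobolevMazya.weightExp n p :=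
    MeasureTheory.withDensity_congr_ae
      ((HardySobolevMazya.gradWeight_ae_eq hy ha hp hpn).fun_comp ENNReal.ofReal)
  rw [hw, HardySobolevMazya.massWeight_eq ha hp hpn]
  exact ⟨fun φ hφ => ⟨A.memLp_gradient hφ, A.memLp hφ⟩, A.exists_compact_injective⟩
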